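/- Let $c,k,t$ be positive integers with $c\ge 6$ and $k\ge t+3$, and assume that $c\ge 4\log_2 t+7$ or $k\ge 2t+3$. For $\ell\ge 1$ let $U_{c,\ell}$ denote the set of all families consisting of $\ell$ pairwise disjoint $c$-subsets (blocks) of $[ck]=\{1,\dots,ck\}$; thus $U_{c,k}$ is the set of all $c$-uniform partitions of $[ck]$. Two families $\mathcal F,\mathcal G\subseteq U_{c,k}$ are cross $t$-intersecting if $|F\cap G|\ge t$ (that is, $F$ and $G$ share at least $t$ blocks) for all $F\in\mathcal F$ and $G\in\mathcal G$. Suppose that $\mathcal F,\mathcal G\subseteq U_{c,k}$ are cross $t$-intersecting with $|\bigcap_{F\in\mathcal F}F|<t$ and $|\bigcap_{G\in\mathcal G}G|<t$, and that $|\mathcal F||\mathcal G|$ is maximum among all such pairs of families. Then one of the following holds. (i) $\mathcal F=\mathcal N_1(T,L,M)$ and $\mathcal G=\mathcal N_1(T,M,L)$ for some $T\in U_{c,t}$ and $L,M\in U_{c,k-1}$ with $T\subseteq L\cap M$ and $|L\cap M|\ge t+\min\{t,2\}$, where $$\mathcal N_1(T,L,M)=\{F\in U_{c,k}: T\subseteq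 F,\ |F\cap L|\ge t+1\}\cup\{F\in U_{c,k}: T\not\subseteq F,\ |F\cap M|=k-2\}.$$ (ii) $\mathcal F=\mathcal G=\mathcal N_2(Z)$ for some $Z\in U_{c,t+2}$, where $\mathcal N_2(Z)=\{F\in U_{c,k}: |F\cap Z|\ge t+1\}$. (iii) $\mathcal F=\mathcal N_3(A_1,A_2,C)$ and $\mathcal G=\mathcal N_3(B_1,B_2,C)$ for some $A_1=\{e_1,e_2\}$, $A_2=\{e_3,e_4\}$, $B_1=\{e_1,e_3\}$, $B_2=\{e_2,e_4\}$, $C=\{e_1,e_4\}$, all in $U_{c,2}$, where $$\mathcal N_3(A_1,A_2,C)=\{F\in U_{c,k}: A_1\subseteq F\text{ or }A_2\subseteq F\text{ or }C\subseteq F\}.$$ Moreover: - if $(k,t)\in\{(4,1),(5,1)\}$, then (i), (ii) or (iii) holds; - if $k=t+3$ and $t\ge 2$, then (i) or (ii) holds; - if $t+4\le k\le 2t+3$ and $(k,t)\ne(5,1)$, then (ii) holds; - if $k\ge 2t+4$, then (i) holds. -/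

import Mathlib

namespace UniformPartition

/-- A family of blocks (subsets) of the ground set `[ck]`, modelled as `Fin (c * k)`. -/
abbrev BlockFamily (c k : ℕ) : Type := Finset (Finset (Fin (c * k)))

/-- `U c k l` is the set of all families of `l` pairwise disjoint `c`-subsets of `[ck]`.
In particular, for `0 < c`, `U c k k` is the set of all `c`-uniform partitions of `[ck]`. -/
def U (c k l : ℕ) : Finset (BlockFamily c k) :=
  Finset.univ.filter fun S =>
    S.card = l ∧ (∀ a ∈ S, a.card = c) ∧ ∀ a ∈ S, ∀ b ∈ S, a ≠ b → Disjoint a b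

/-- Any member of `FF` and any member of `GG` share at least `t` blocks. -/
def CrossIntersecting {c k : ℕ} (t : ℕ) (FF GG : Finset (BlockFamily c k)) : Prop :=
  ∀ F ∈ FF, ∀ G ∈ GG, t ≤ (F ∩ G).card

/-- The set of blocks that lie in every member of `FF`, that is, the intersection of all the
members of `FF`. -/
def commonBlocks {c k : ℕ} (FF : Finset (BlockFamily c k)) : BlockFamily c k :=
  Finset.univ.filter fun b => ∀ F ∈ FF, b ∈ F

/-- `FF` and `GG` are cross `t`-intersecting families of `c`-uniform partitions of `[ck]`,
each having fewer than `t` common blocks. -/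
def IsNontrivialCrossPair (c k t : ℕ) (FF GG : Finset (BlockFamily c k)) : Prop :=
  FF ⊆ U c k k ∧ GG ⊆ U c k k ∧ CrossIntersecting t FF GG ∧
    (commonBlocks FF).card < t ∧ (commonBlocks GG).card < t

/-- `FF` and `GG` have the maximum product of sizes among all pairs as above. -/
def IsMaxNontrivialCrossPair (c k t : ℕ) (FF GG : Finset (BlockFamily c k)) : Prop :=
  IsNontrivialCrossPair c k t FF GG ∧
    ∀ FF' GG' : Finset (BlockFamily c k), IsNontrivialCrossPair c k t FF' GG' →
      FF'.card * GG'.card ≤ FF.card * GG.card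

/-- The family `N₁(T, L, M)`. -/
def N₁ (c k t : ℕ) (T L M : BlockFamily c k) : Finset (BlockFamily c k) :=
  ((U c k k).filter fun F => T ⊆ F ∧ t + 1 ≤ (F ∩ L).card) ∪
    ((U c k k).filter fun F => ¬ T ⊆ F ∧ (F ∩ M).card = k - 2)

/-- The family `N₂(Z)`. -/
def N₂ (c k t : ℕ) (Z : BlockFamily c k) : Finset (BlockFamily c k) :=
  (U c k k).filter fun F => t + 1 ≤ (F ∩ Z).card

/-- The family `N₃(A₁, A₂, C)`. -/
def N₃ (c k : ℕ) (A₁ A₂ C : BlockFamily c k) : Finset (BlockFamily c k) :=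
  (U c k k).filter fun F => A₁ ⊆ F ∨ A₂ ⊆ F ∨ C ⊆ F

/-- The pair is `(N₁(T, L, M), N₁(T, M, L))` for suitable `T`, `L`, `M`. -/
def IsFirstType (c k t : ℕ) (FF GG : Finset (BlockFamily c k)) : Prop :=
  ∃ T ∈ U c k t, ∃ L ∈ U c k (k - 1), ∃ M ∈ U c k (k - 1),
    T ⊆ L ∩ M ∧ t + min t 2 ≤ (L ∩ M).card ∧
      FF = N₁ c k t T L M ∧ GG = N₁ c k t T M L

/-- Both families are `N₂(Z)` for the same `Z`. -/
def IsSecondType (c k t : ℕ) (FF GG : Finset (BlockFamily c k)) : Prop :=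
  ∃ Z ∈ U c k (t + 2), FF = N₂ c k t Z ∧ GG = N₂ c k t Z

/-- The pair is `(N₃(A₁, A₂, C), N₃(B₁, B₂, C))` with `A₁ = {e₁, e₂}`, `A₂ = {e₃, e₄}`,
`B₁ = {e₁, e₃}`, `B₂ = {e₂, e₄}`, `C = {e₁, e₄}`, each consisting of two disjoint blocks. -/
def IsThirdType (c k : ℕ) (FF GG : Finset (BlockFamily c k)) : Prop :=
  ∃ e₁ e₂ e₃ e₄ : Finset (Fin (c * k)),
    {e₁, e₂} ∈ U c k 2 ∧ {e₃, e₄} ∈ U c k 2 ∧ {e₁, e₃} ∈ U c k 2 ∧ {e₂, e₄} ∈ U c k 2 ∧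
      {e₁, e₄} ∈ U c k 2 ∧
      FF = N₃ c k {e₁, e₂} {e₃, e₄} {e₁, e₄} ∧ GG = N₃ c k {e₁, e₃} {e₂, e₄} {e₁, e₄}

end UniformPartition

/-!
Write `j = k - t - 1` and `m = max (t + 2) j`, and let `p i` be the number of partitions of
`c * i` points into blocks of size `c`, so that `p (k - s)` partitions contain `s` given disjoint
blocks (`card_above`). Since `p i = (c * i - 1).choose (c - 1) * p (i - 1)`, the hypotheses on
`c`, `k`, `t` make `p j` at least `7 * m ^ 5 * p (j - 1)` (`growth_estimates`), so that the size
of a family is governed by the number of partitions in it that contain one of certain sets of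
`t + 1` blocks.

Call a set of blocks a cover of a family if every member contains at least `t` of them. A set `S`
of `s` disjoint blocks that is not a cover of `GG` can be extended, inside any `F ∈ FF` that
contains it, by one of at most `k - s` blocks: take a `G ∈ GG` that shares fewer than `t` blocks
with `S`, and one of the blocks of `G` disjoint from `S`. Iterating this from the `t`-subsets of a
smallest cover of `FF` bounds `|FF|`, and symmetrically `|GG|`
(`card_le_choose_mul_descFactorial`). The product of the two bounds splits into one factor for
each family, `coverWeight`, which is at most `p j / 2` once the smallest cover has more than
`t + 1` blocks. The examples `N₁ T L L` and `N₂ Z` show that the optimal product is at least about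
`(m * p j) ^ 2`, so in a maximum pair both families have covers of `t + 1` blocks
(`covers_nonempty`).

Let `𝒜` and `ℬ` be the sets of covers with `t + 1` blocks of `GG` and of `FF`. By maximality every
partition that contains a member of `𝒜` lies in `FF`, which makes `𝒜` and `ℬ` cross
`t`-intersecting; up to lower order terms `|FF| = |𝒜| * p j` and `|GG| = |ℬ| * p j`, so that
`m ^ 2 ≤ |𝒜| * |ℬ|` (`sq_le_card_covers_mul_card_covers`). At most `j` members of `𝒜` contain a
given set of `t` blocks (`star_structure`). These facts leave three possibilities
(`crossIntersecting_structure`): all members of `𝒜` and `ℬ` contain a common `T`; they are the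
`(t + 1)`-subsets of some `Z`; or `t = 1`, `j ≤ 3`, and they form a particular pair of families of
three 2-sets. In the last two cases `FF` and `GG` are read off from `𝒜` and `ℬ`. In the first case
`j = m` and `FF ⊆ N₁ T L M`, `GG ⊆ N₁ T M L`, where `L` and `M` are the unions of `𝒜` and `ℬ`; if
`|L ∩ M|` is too small then the first inclusion is strict and one of the pairs formed from
`N₁ T L L` or `N₁ T M M` is larger. When `j = t + 2` and `t ≥ 2` the leading terms for `N₁` and
`N₂` agree, and the next ones favour `N₂` (`card_N₁_lt_card_N₂`). When `k = t + 3` every pair of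
the first type is also one of the second or third type, so that the first type need not be
considered there.
-/

namespace UniformPartition

/-! ### Counting uniform partitions -/

section Count

variable {α : Type*} [DecidableEq α]

/-- The number of partitions of a set of `c * m` points into `m` blocks of size `c`, given by the
recursion that chooses the block of a fixed point. -/
def partitionCount (c : ℕ) : ℕ → ℕ
  | 0 => 1
  | m + 1 => (c * (m + 1) - 1).choose (c - 1) * partitionCount c m

/-- The families of `m` pairwise disjoint `c`-subsets of `X`. -/
def disjointFamilies (c m : ℕ) (X : Finset α) : Finset (Finset (Finset α)) :=
  ((X.powersetCard c).powersetCard m).filter fun Q => ∀ a ∈ Q, ∀ b ∈ Q, a ≠ b → Disjoint a b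

lemma mem_disjointFamilies {c m : ℕ} {X : Finset α} {Q : Finset (Finset α)} :
    Q ∈ disjointFamilies c m X ↔ Q.card = m ∧ (∀ a ∈ Q, a ⊆ X) ∧ (∀ a ∈ Q, a.card = c) ∧
      ∀ a ∈ Q, ∀ b ∈ Q, a ≠ b → Disjoint a b := by
  simp only [disjointFamilies, Finset.mem_filter, Finset.mem_powersetCard, Finset.subset_iff]
  constructor
  · rintro ⟨⟨h1, h2⟩, h3⟩
    exact ⟨h2, fun a ha => (h1 ha).1, fun a ha => (h1 ha).2, h3⟩
  · rintro ⟨h1, h2, h3, h4⟩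
    exact ⟨⟨fun a ha => ⟨h2 a ha, h3 a ha⟩, h1⟩, h4⟩

lemma card_biUnion_of_uniform {c : ℕ} {Q : Finset (Finset α)} (hc : ∀ a ∈ Q, a.card = c)
    (hd : ∀ a ∈ Q, ∀ b ∈ Q, a ≠ b → Disjoint a b) : (Q.biUnion id).card = c * Q.card := by
  rw [Finset.card_biUnion (t := id) (fun a ha b hb hab => hd a ha b hb hab),
    Finset.sum_congr rfl (fun a ha => (hc a ha : (id a).card = c)), Finset.sum_const,
    smul_eq_mul, mul_comm]

lemma biUnion_eq_of_mem_disjointFamilies {c m : ℕ} {X : Finset α} (hX : X.card = c * m)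
    {Q : Finset (Finset α)} (hQ : Q ∈ disjointFamilies c m X) : Q.biUnion id = X := by
  obtain ⟨h1, h2, h3, h4⟩ := mem_disjointFamilies.1 hQ
  refine Finset.eq_of_subset_of_card_le (Finset.biUnion_subset.2 h2) ?_
  rw [card_biUnion_of_uniform h3 h4, h1, hX]

lemma card_disjointFamilies {c : ℕ} (hc : 0 < c) (m : ℕ) (X : Finset α) (hX : X.card = c * m) :
    (disjointFamilies c m X).card = partitionCount c m := by
  induction m generalizing X with
  | zero =>
    have : disjointFamilies c 0 X = {∅} := by
      ext Q
      rw [mem_disjointFamilies, Finset.card_eq_zero, Finset.mem_singleton]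
      constructor
      · exact fun h => h.1
      · rintro rfl; simp
    rw [this]; simp [partitionCount]
  | succ m ih =>
    have hpos : 0 < X.card := by rw [hX]; positivity
    obtain ⟨x, hx⟩ := Finset.card_pos.1 hpos
    -- the possible blocks of `x`
    set B : Finset (Finset α) := ((X.erase x).powersetCard (c - 1)).image (insert x) with hB
    have memB : ∀ b, b ∈ B ↔ b ⊆ X ∧ b.card = c ∧ x ∈ b := by
      intro b
      simp only [hB, Finset.mem_image, Finset.mem_powersetCard]
      constructor
      · rintro ⟨a, ⟨ha, hac⟩, rfl⟩
        have hxa : x ∉ a := fun h => by simpa using ha h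
        refine ⟨Finset.insert_subset hx (ha.trans (Finset.erase_subset _ _)), ?_,
          Finset.mem_insert_self _ _⟩
        rw [Finset.card_insert_of_notMem hxa, hac]; omega
      · rintro ⟨h1, h2, h3⟩
        exact ⟨b.erase x, ⟨Finset.erase_subset_erase _ h1, by
          rw [Finset.card_erase_of_mem h3, h2]⟩, Finset.insert_erase h3⟩
    have cardB : B.card = (c * (m + 1) - 1).choose (c - 1) := by
      rw [hB, Finset.card_image_of_injOn, Finset.card_powersetCard, Finset.card_erase_of_mem hx, hX]
      intro a ha b hb hab
      rw [Finset.mem_coe, Finset.mem_powersetCard] at ha hb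
      have hxa : x ∉ a := fun h => by simpa using ha.1 h
      have hxb : x ∉ b := fun h => by simpa using hb.1 h
      have := congrArg (Finset.erase · x) hab
      simpa [Finset.erase_insert hxa, Finset.erase_insert hxb] using this
    have key : disjointFamilies c (m + 1) X =
        B.biUnion fun b => (disjointFamilies c m (X \ b)).image (insert b) := by
      ext Q
      simp only [Finset.mem_biUnion, Finset.mem_image]
      constructor
      · intro hQ
        have hu := biUnion_eq_of_mem_disjointFamilies hX hQ
        obtain ⟨h1, h2, h3, h4⟩ := mem_disjointFamilies.1 hQ
        rw [← hu] at hx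
        obtain ⟨b, hb, hxb⟩ := Finset.mem_biUnion.1 hx
        refine ⟨b, (memB b).2 ⟨h2 b hb, h3 b hb, hxb⟩, Q.erase b, ?_, Finset.insert_erase hb⟩
        rw [mem_disjointFamilies]
        refine ⟨by rw [Finset.card_erase_of_mem hb, h1]; rfl, fun a ha => ?_,
          fun a ha => h3 a (Finset.mem_of_mem_erase ha),
          fun a ha a' ha' => h4 a (Finset.mem_of_mem_erase ha) a' (Finset.mem_of_mem_erase ha')⟩
        rw [Finset.mem_erase] at ha
        exact Finset.subset_sdiff.2 ⟨h2 a ha.2, h4 a ha.2 b hb ha.1⟩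
      · rintro ⟨b, hb, Q', hQ', rfl⟩
        obtain ⟨hb1, hb2, hb3⟩ := (memB b).1 hb
        obtain ⟨h1, h2, h3, h4⟩ := mem_disjointFamilies.1 hQ'
        have hdis : ∀ a ∈ Q', Disjoint a b := fun a ha => (Finset.subset_sdiff.1 (h2 a ha)).2
        have hbQ : b ∉ Q' := fun h => by
          have := hdis b h
          rw [disjoint_self, Finset.bot_eq_empty] at this
          simp [this] at hb3
        rw [mem_disjointFamilies]
        refine ⟨by rw [Finset.card_insert_of_notMem hbQ, h1], ?_, ?_, ?_⟩
        · intro a ha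
          rcases Finset.mem_insert.1 ha with rfl | ha
          · exact hb1
          · exact (h2 a ha).trans Finset.sdiff_subset
        · intro a ha
          rcases Finset.mem_insert.1 ha with rfl | ha
          · exact hb2
          · exact h3 a ha
        · intro a ha a' ha' hne
          rcases Finset.mem_insert.1 ha with e | e <;>
            rcases Finset.mem_insert.1 ha' with e' | e'
          · exact absurd (e.trans e'.symm) hne
          · exact e ▸ (hdis a' e').symm
          · exact e' ▸ hdis a e
          · exact h4 a e a' e' hne
    have hnot : ∀ b ∈ B, ∀ Q ∈ disjointFamilies c m (X \ b), b ∉ Q := by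
      intro b hb Q hQ h
      have := (mem_disjointFamilies.1 hQ).2.1 b h ((memB b).1 hb).2.2
      simp [((memB b).1 hb).2.2] at this
    rw [key, Finset.card_biUnion, Finset.sum_congr rfl (g := fun _ => partitionCount c m),
      Finset.sum_const, cardB, smul_eq_mul, partitionCount]
    · intro b hb
      rw [Finset.card_image_of_injOn]
      · apply ih
        rw [Finset.card_sdiff_of_subset ((memB b).1 hb).1, hX, ((memB b).1 hb).2.1]
        rw [Nat.mul_succ]; omega
      · intro Q hQ Q' hQ' h
        have := congrArg (Finset.erase · b) h
        simpa [Finset.erase_insert (hnot b hb Q hQ), Finset.erase_insert (hnot b hb Q' hQ')]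
          using this
    · intro b hb b' hb' hne
      rw [Function.onFun, Finset.disjoint_left]
      intro Q hQ hQ'
      obtain ⟨R, hR, rfl⟩ := Finset.mem_image.1 hQ
      obtain ⟨R', hR', hRR⟩ := Finset.mem_image.1 hQ'
      have hb'' : b' ∈ insert b R := by rw [← hRR]; exact Finset.mem_insert_self _ _
      rcases Finset.mem_insert.1 hb'' with h | h
      · exact hne h.symm
      · have := (mem_disjointFamilies.1 hR).2.1 b' h ((memB b').1 hb').2.2
        simp [((memB b).1 hb).2.2] at this

end Count

/-! ### Partitions that contain given blocks -/

section Above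

variable {c k s : ℕ} {S : BlockFamily c k}

lemma mem_U : S ∈ U c k s ↔ S.card = s ∧ (∀ a ∈ S, a.card = c) ∧
    ∀ a ∈ S, ∀ b ∈ S, a ≠ b → Disjoint a b := by
  simp [U]

lemma card_of_mem_U (hS : S ∈ U c k s) : S.card = s := (mem_U.1 hS).1

lemma mem_U_of_subset {S' : BlockFamily c k} (hS : S ∈ U c k s) (h : S' ⊆ S) :
    S' ∈ U c k S'.card := by
  obtain ⟨-, h2, h3⟩ := mem_U.1 hS
  exact mem_U.2 ⟨rfl, fun a ha => h2 a (h ha), fun a ha b hb => h3 a (h ha) b (h hb)⟩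

lemma card_biUnion_of_mem_U (hS : S ∈ U c k s) : (S.biUnion id).card = c * s := by
  obtain ⟨h1, h2, h3⟩ := mem_U.1 hS
  rw [card_biUnion_of_uniform h2 h3, h1]

lemma le_of_mem_U (hc : 0 < c) (hS : S ∈ U c k s) : s ≤ k := by
  have h := Finset.card_le_univ (S.biUnion id)
  rw [card_biUnion_of_mem_U hS, Fintype.card_fin] at h
  exact Nat.le_of_mul_le_mul_left h hc

/-- The `c`-uniform partitions of `[ck]` that contain all the blocks in `S`. -/
def above (S : BlockFamily c k) : Finset (BlockFamily c k) := (U c k k).filter (S ⊆ ·)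

lemma mem_above {F : BlockFamily c k} : F ∈ above S ↔ F ∈ U c k k ∧ S ⊆ F := by simp [above]

lemma card_above (hc : 0 < c) (hS : S ∈ U c k s) :
    (above S).card = partitionCount c (k - s) := by
  have hsk := le_of_mem_U hc hS
  set X : Finset (Fin (c * k)) := Finset.univ \ S.biUnion id with hX
  have hXc : X.card = c * (k - s) := by
    rw [hX, Finset.card_sdiff_of_subset (Finset.subset_univ _), Finset.card_univ,
      Fintype.card_fin, card_biUnion_of_mem_U hS, Nat.mul_sub]
  obtain ⟨s1, s2, s3⟩ := mem_U.1 hS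
  have hdis : ∀ Q ∈ disjointFamilies c (k - s) X, ∀ a ∈ Q, ∀ b ∈ S, Disjoint a b := by
    intro Q hQ a ha b hb
    have := (Finset.subset_sdiff.1 ((mem_disjointFamilies.1 hQ).2.1 a ha)).2
    exact this.mono_right (Finset.subset_biUnion_of_mem id hb)
  have hdisj : ∀ Q ∈ disjointFamilies c (k - s) X, Disjoint S Q := by
    intro Q hQ
    rw [Finset.disjoint_left]
    intro a ha haQ
    have := hdis Q hQ a haQ a ha
    rw [disjoint_self, Finset.bot_eq_empty] at this
    have h := s2 a ha
    rw [this, Finset.card_empty] at h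
    omega
  rw [← card_disjointFamilies hc (k - s) X hXc]
  symm
  refine Finset.card_bij (fun Q _ => S ∪ Q) ?_ ?_ ?_
  · intro Q hQ
    obtain ⟨h1, h2, h3, h4⟩ := mem_disjointFamilies.1 hQ
    refine mem_above.2 ⟨mem_U.2 ⟨?_, ?_, ?_⟩, Finset.subset_union_left⟩
    · rw [Finset.card_union_of_disjoint (hdisj Q hQ), s1, h1]; omega
    · intro a ha
      rcases Finset.mem_union.1 ha with ha | ha
      · exact s2 a ha
      · exact h3 a ha
    · intro a ha b hb hne
      rcases Finset.mem_union.1 ha with ha | ha <;> rcases Finset.mem_union.1 hb with hb | hb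
      · exact s3 a ha b hb hne
      · exact (hdis Q hQ b hb a ha).symm
      · exact hdis Q hQ a ha b hb
      · exact h4 a ha b hb hne
  · intro Q hQ Q' hQ' h
    have := congrArg (· \ S) h
    simpa [Finset.union_sdiff_cancel_left (hdisj Q hQ),
      Finset.union_sdiff_cancel_left (hdisj Q' hQ')] using this
  · intro F hF
    obtain ⟨hFU, hSF⟩ := mem_above.1 hF
    obtain ⟨f1, f2, f3⟩ := mem_U.1 hFU
    refine ⟨F \ S, ?_, Finset.union_sdiff_of_subset hSF⟩
    refine mem_disjointFamilies.2 ⟨by rw [Finset.card_sdiff_of_subset hSF, f1, s1], ?_,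
      fun a ha => f2 a (Finset.mem_sdiff.1 ha).1,
      fun a ha b hb => f3 a (Finset.mem_sdiff.1 ha).1 b (Finset.mem_sdiff.1 hb).1⟩
    intro a ha
    rw [Finset.mem_sdiff] at ha
    refine Finset.subset_sdiff.2 ⟨Finset.subset_univ _, ?_⟩
    rw [Finset.disjoint_biUnion_right]
    intro b hb
    exact f3 a ha.1 b (hSF hb) (fun h => ha.2 (h ▸ hb))

end Above

/-! ### Growth of the number of partitions -/

section PartitionCount

variable {c : ℕ}

/-- The factor by which `partitionCount c` grows from `i - 1` to `i`. -/
def blockRatio (c i : ℕ) : ℕ := (c * i - 1).choose (c - 1)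

lemma partitionCount_zero : partitionCount c 0 = 1 := rfl

lemma partitionCount_succ (i : ℕ) :
    partitionCount c (i + 1) = blockRatio c (i + 1) * partitionCount c i := rfl

lemma blockRatio_one : blockRatio c 1 = 1 := by simp [blockRatio]

lemma partitionCount_one : partitionCount c 1 = 1 := by
  rw [partitionCount_succ, blockRatio_one, partitionCount_zero]

lemma blockRatio_pos {i : ℕ} (hi : 0 < i) : 0 < blockRatio c i := by
  refine Nat.choose_pos ?_
  exact Nat.sub_le_sub_right (Nat.le_mul_of_pos_right c hi) 1

lemma partitionCount_pos (i : ℕ) : 0 < partitionCount c i := by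
  induction i with
  | zero => simp [partitionCount_zero]
  | succ i ih => rw [partitionCount_succ]; exact Nat.mul_pos (blockRatio_pos i.succ_pos) ih

lemma partitionCount_mono : Monotone (partitionCount c) :=
  monotone_nat_of_le_succ fun i => by
    rw [partitionCount_succ]
    exact Nat.le_mul_of_pos_left _ (blockRatio_pos i.succ_pos)

lemma blockRatio_mono : Monotone (blockRatio c) := fun _ _ h =>
  Nat.choose_le_choose _ (Nat.sub_le_sub_right (Nat.mul_le_mul_left c h) 1)

/-- The growth factor increases with the block size, by Pascal's rule. -/
lemma blockRatio_le_succ_left {i : ℕ} (hc : 0 < c) (hi : 0 < i) :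
    blockRatio c i ≤ blockRatio (c + 1) i := by
  obtain ⟨d, rfl⟩ : ∃ d, c = d + 1 := ⟨c - 1, by omega⟩
  obtain ⟨e, rfl⟩ : ∃ e, i = e + 1 := ⟨i - 1, by omega⟩
  rw [blockRatio, blockRatio]
  have h1 : (d + 1 + 1) * (e + 1) - 1 = (d + 1) * (e + 1) - 1 + e + 1 := by
    have : (d + 1) * (e + 1) = (d + 1) * e + d + 1 := by ring
    have h' : (d + 1 + 1) * (e + 1) = (d + 1) * e + d + 1 + e + 1 := by ring
    omega
  rw [h1, Nat.add_sub_cancel, Nat.add_sub_cancel, Nat.choose_succ_succ]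
  exact (Nat.choose_le_choose d (Nat.le_add_right _ e)).trans (Nat.le_add_right _ _)

lemma blockRatio_le_of_le_left {c' i : ℕ} (hc : 0 < c) (hi : 0 < i) (h : c ≤ c') :
    blockRatio c i ≤ blockRatio c' i := by
  induction c', h using Nat.le_induction with
  | base => exact le_rfl
  | succ n hn ih => exact ih.trans (blockRatio_le_succ_left (hc.trans_le hn) hi)

end PartitionCount

/-! ### Extending a family of disjoint blocks -/

section Above

variable {c k s t : ℕ} {S : BlockFamily c k}

lemma insert_mem_U (hc : 0 < c) (hS : S ∈ U c k s) {e : Finset (Fin (c * k))} (he : e.card = c)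
    (hd : ∀ a ∈ S, Disjoint a e) : e ∉ S ∧ insert e S ∈ U c k (s + 1) := by
  obtain ⟨h1, h2, h3⟩ := mem_U.1 hS
  have heS : e ∉ S := fun h => by
    have := hd e h
    rw [disjoint_self, Finset.bot_eq_empty] at this
    rw [this, Finset.card_empty] at he
    omega
  refine ⟨heS, mem_U.2 ⟨by rw [Finset.card_insert_of_notMem heS, h1], ?_, ?_⟩⟩
  · simpa [he] using h2
  · intro a ha b hb hne
    rcases Finset.mem_insert.1 ha with ea | ea <;> rcases Finset.mem_insert.1 hb with eb | eb
    · exact absurd (ea.trans eb.symm) hne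
    · exact ea ▸ (hd b eb).symm
    · exact eb ▸ hd a ea
    · exact h3 a ea b eb hne

lemma exists_mem_above (hc : 0 < c) (hS : S ∈ U c k s) : ∃ F ∈ U c k k, S ⊆ F := by
  have h : 0 < (above S).card := by rw [card_above hc hS]; exact partitionCount_pos _
  obtain ⟨F, hF⟩ := Finset.card_pos.1 h
  exact ⟨F, mem_above.1 hF⟩

lemma exists_mem_U (hc : 0 < c) (hs : s ≤ k) : ∃ S, S ∈ U c k s := by
  have h0 : (∅ : BlockFamily c k) ∈ U c k 0 := mem_U.2 (by simp)
  obtain ⟨F, hF, -⟩ := exists_mem_above hc h0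
  obtain ⟨S, hSF, hS⟩ := Finset.exists_subset_card_eq (hs.trans_eq (card_of_mem_U hF).symm)
  exact ⟨S, hS ▸ mem_U_of_subset hF hSF⟩

/-- The last block of a partition is determined by the others. -/
lemma eq_of_common_pred (hc : 0 < c) (hk : 0 < k) (hS : S ∈ U c k (k - 1))
    {F F' : BlockFamily c k} (hF : F ∈ U c k k) (hF' : F' ∈ U c k k) (h : S ⊆ F) (h' : S ⊆ F') :
    F = F' := by
  have h1 : (above S).card = 1 := by
    rw [card_above hc hS, Nat.sub_sub_self hk, partitionCount_one]
  exact Finset.card_le_one.1 h1.le F (mem_above.2 ⟨hF, h⟩) F' (mem_above.2 ⟨hF', h'⟩)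

lemma card_above_insert_le (hc : 0 < c) (hS : S ∈ U c k s) {b : Finset (Fin (c * k))}
    (hb : b ∉ S) : (above (insert b S)).card ≤ partitionCount c (k - s - 1) := by
  rcases (above (insert b S)).eq_empty_or_nonempty with h | ⟨F, hF⟩
  · simp [h]
  · obtain ⟨h1, h2⟩ := mem_above.1 hF
    have := mem_U_of_subset h1 h2
    rw [Finset.card_insert_of_notMem hb, card_of_mem_U hS] at this
    rw [card_above hc this, Nat.sub_sub]

lemma exists_above_disjoint (hc : 0 < c) (hS : S ∈ U c k s) {X : BlockFamily c k}
    (hX : Disjoint S X) (h : X.card * partitionCount c (k - s - 1) < partitionCount c (k - s)) :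
    ∃ F ∈ U c k k, S ⊆ F ∧ Disjoint F X := by
  by_contra! hcon
  have hsub : above S ⊆ X.biUnion fun b => above (insert b S) := by
    intro F hF
    obtain ⟨h1, h2⟩ := mem_above.1 hF
    obtain ⟨b, hbF, hbX⟩ := Finset.not_disjoint_iff.1 (hcon F h1 h2)
    exact Finset.mem_biUnion.2 ⟨b, hbX, mem_above.2 ⟨h1, Finset.insert_subset hbF h2⟩⟩
  have := Finset.card_le_card hsub
  rw [card_above hc hS] at this
  have h2 := Finset.card_biUnion_le_card_mul X (fun b => above (insert b S)) _
    (fun b hb => card_above_insert_le hc hS (Finset.disjoint_right.1 hX hb))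
  omega

/-- Blocks of a partition that extend `S` one at a time also extend `S` jointly. -/
lemma union_mem_U (hS : S ∈ U c k s) {G E : BlockFamily c k} (hG : G ∈ U c k k) (hEG : E ⊆ G)
    (hE : ∀ e ∈ E, insert e S ∈ U c k (s + 1)) : Disjoint S E ∧ S ∪ E ∈ U c k (s + E.card) := by
  have hnot : ∀ e ∈ E, e ∉ S := fun e he h => by
    have := card_of_mem_U (hE e he)
    rw [Finset.insert_eq_of_mem h, card_of_mem_U hS] at this
    omega
  have hdis : Disjoint S E := Finset.disjoint_right.2 hnot
  obtain ⟨s1, s2, s3⟩ := mem_U.1 hS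
  obtain ⟨g1, g2, g3⟩ := mem_U.1 hG
  have hd : ∀ a ∈ S, ∀ e ∈ E, Disjoint a e := fun a ha e he =>
    (mem_U.1 (hE e he)).2.2 a (Finset.mem_insert_of_mem ha) e (Finset.mem_insert_self _ _)
      (fun h => hnot e he (h ▸ ha))
  refine ⟨hdis, mem_U.2 ⟨?_, ?_, ?_⟩⟩
  · rw [Finset.card_union_of_disjoint hdis, s1]
  · intro a ha
    rcases Finset.mem_union.1 ha with ha | ha
    · exact s2 a ha
    · exact g2 a (hEG ha)
  · intro a ha b hb hne
    rcases Finset.mem_union.1 ha with ha | ha <;> rcases Finset.mem_union.1 hb with hb | hb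
    · exact s3 a ha b hb hne
    · exact hd a ha b hb
    · exact (hd b hb a ha).symm
    · exact g3 a (hEG ha) b (hEG hb) hne

/-- At most `k - s` blocks of `G` can be added to `S`. -/
lemma card_extending_blocks (hc : 0 < c) (hS : S ∈ U c k s) {G : BlockFamily c k}
    (hG : G ∈ U c k k) : s + (G.filter fun e => insert e S ∈ U c k (s + 1)).card ≤ k :=
  le_of_mem_U hc (union_mem_U hS hG (Finset.filter_subset _ _)
    fun _ he => (Finset.mem_filter.1 he).2).2

/-- A partition that contains `S` and shares more blocks with `G` than `S` does contains a block of
`G` that extends `S`. -/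
lemma exists_extending_block {F G : BlockFamily c k} (hS : S ∈ U c k s)
    (hF : F ∈ U c k k) (hSF : S ⊆ F) (hlt : (G ∩ S).card < t) (hle : t ≤ (F ∩ G).card) :
    ∃ e ∈ G.filter fun e => insert e S ∈ U c k (s + 1), insert e S ⊆ F := by
  have : ∃ e ∈ F ∩ G, e ∉ G ∩ S := by
    by_contra! h
    have := Finset.card_le_card (show F ∩ G ⊆ G ∩ S from h)
    omega
  obtain ⟨e, he, heS⟩ := this
  rw [Finset.mem_inter] at he heS
  have hsub : insert e S ⊆ F := Finset.insert_subset he.1 hSF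
  refine ⟨e, Finset.mem_filter.2 ⟨he.2, ?_⟩, hsub⟩
  have := mem_U_of_subset hF hsub
  rwa [Finset.card_insert_of_notMem (fun h => heS ⟨he.2, h⟩), card_of_mem_U hS] at this

end Above

/-! ### Covers -/

section Cover

variable {c k t : ℕ} {FF GG : Finset (BlockFamily c k)}

/-- Every member of `FF` contains at least `t` of the blocks in `S`. -/
def IsCover (t : ℕ) (FF : Finset (BlockFamily c k)) (S : BlockFamily c k) : Prop :=
  ∀ F ∈ FF, t ≤ (F ∩ S).card

lemma CrossIntersecting.symm (h : CrossIntersecting t FF GG) : CrossIntersecting t GG FF :=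
  fun G hG F hF => by rw [Finset.inter_comm]; exact h F hF G hG

/-- One step of the extension argument: `FF` restricted to the partitions containing `S` is covered
by the restrictions to the one-block extensions of `S`, if `S` is not a cover of `GG`. -/
lemma card_filter_superset_le (hc : 0 < c) (hFU : FF ⊆ U c k k) (hGU : GG ⊆ U c k k)
    (hcr : CrossIntersecting t FF GG) {s N : ℕ} {S : BlockFamily c k} (hS : S ∈ U c k s)
    (hnc : ¬ IsCover t GG S)
    (hN : ∀ e, insert e S ∈ U c k (s + 1) → (FF.filter (insert e S ⊆ ·)).card ≤ N) :
    (FF.filter (S ⊆ ·)).card ≤ (k - s) * N := by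
  rw [IsCover] at hnc
  push Not at hnc
  obtain ⟨G, hG, hlt⟩ := hnc
  set E := G.filter fun e => insert e S ∈ U c k (s + 1)
  have hE : E.card ≤ k - s := by
    have : s + E.card ≤ k := card_extending_blocks hc hS (hGU hG)
    omega
  have hsub : FF.filter (S ⊆ ·) ⊆ E.biUnion fun e => FF.filter (insert e S ⊆ ·) := by
    intro F hF
    obtain ⟨hF, hSF⟩ := Finset.mem_filter.1 hF
    obtain ⟨e, he, hsub⟩ := exists_extending_block hS (hFU hF) hSF hlt (hcr F hF G hG)
    exact Finset.mem_biUnion.2 ⟨e, he, Finset.mem_filter.2 ⟨hF, hsub⟩⟩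
  calc _ ≤ _ := Finset.card_le_card hsub
    _ ≤ E.card * N := Finset.card_biUnion_le_card_mul _ _ _
        fun e he => hN e (Finset.mem_filter.1 he).2
    _ ≤ _ := Nat.mul_le_mul_right _ hE

lemma card_filter_superset_le_above (hc : 0 < c) (hFU : FF ⊆ U c k k) {s : ℕ}
    {S : BlockFamily c k} (hS : S ∈ U c k s) :
    (FF.filter (S ⊆ ·)).card ≤ partitionCount c (k - s) := by
  rw [← card_above hc hS]
  exact Finset.card_le_card (Finset.filter_subset_filter _ hFU)

lemma card_filter_superset_le_descFactorial (hc : 0 < c) (hFU : FF ⊆ U c k k)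
    (hGU : GG ⊆ U c k k) (hcr : CrossIntersecting t FF GG) {b : ℕ}
    (hb : ∀ s < b, ∀ S ∈ U c k s, ∀ F ∈ FF, S ⊆ F → ¬ IsCover t GG S) (d : ℕ) :
    ∀ s, s + d = b → ∀ S ∈ U c k s,
      (FF.filter (S ⊆ ·)).card ≤ (k - s).descFactorial d * partitionCount c (k - b) := by
  induction d with
  | zero =>
    rintro s rfl S hS
    simpa using card_filter_superset_le_above hc hFU hS
  | succ d ih =>
    intro s hs S hS
    rcases (FF.filter (S ⊆ ·)).eq_empty_or_nonempty with hempty | ⟨F, hF⟩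
    · rw [hempty]; exact Nat.zero_le _
    have hnc := hb s (by omega) S hS F (Finset.mem_filter.1 hF).1 (Finset.mem_filter.1 hF).2
    rcases Nat.eq_zero_or_pos (k - s) with h0 | hpos
    · have := card_filter_superset_le hc hFU hGU hcr hS hnc (N := FF.card)
        (fun e _ => Finset.card_filter_le _ _)
      rw [h0, zero_mul] at this
      omega
    · have := card_filter_superset_le hc hFU hGU hcr hS hnc
        (fun e he => ih (s + 1) (by omega) _ he)
      rw [← mul_assoc] at this
      obtain ⟨n, hn⟩ : ∃ n, k - s = n + 1 := ⟨k - s - 1, by omega⟩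
      have hn' : k - (s + 1) = n := by omega
      rwa [hn, hn', ← Nat.succ_descFactorial_succ, ← hn] at this

/-- Suppose that `S` is a cover of `FF`, and that no family of fewer than `b` blocks of a member of
`FF` is a cover of `GG`. Then every member of `FF` arises by choosing `t` of the blocks in `S` and
extending them `b - t` times. -/
lemma card_le_choose_mul_descFactorial (hc : 0 < c) (hFU : FF ⊆ U c k k)
    (hGU : GG ⊆ U c k k) (hcr : CrossIntersecting t FF GG) {a b : ℕ} (htb : t ≤ b)
    (hb : ∀ s < b, ∀ S ∈ U c k s, ∀ F ∈ FF, S ⊆ F → ¬ IsCover t GG S) {S : BlockFamily c k}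
    (hS : S ∈ U c k a) (hcov : IsCover t FF S) :
    FF.card ≤ a.choose t * ((k - t).descFactorial (b - t) * partitionCount c (k - b)) := by
  have hsub : FF ⊆ (S.powersetCard t).biUnion fun T => FF.filter (T ⊆ ·) := by
    intro F hF
    obtain ⟨T, hT, hTc⟩ := Finset.exists_subset_card_eq (hcov F hF)
    refine Finset.mem_biUnion.2 ⟨T, Finset.mem_powersetCard.2
      ⟨hT.trans Finset.inter_subset_right, hTc⟩,
      Finset.mem_filter.2 ⟨hF, hT.trans Finset.inter_subset_left⟩⟩
  rw [← card_of_mem_U hS, ← Finset.card_powersetCard]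
  refine (Finset.card_le_card hsub).trans (Finset.card_biUnion_le_card_mul _ _ _ fun T hT => ?_)
  obtain ⟨hTS, hTc⟩ := Finset.mem_powersetCard.1 hT
  exact card_filter_superset_le_descFactorial hc hFU hGU hcr hb (b - t) t (by omega) T
    (hTc ▸ mem_U_of_subset hS hTS)

lemma not_isCover_of_card_le (hne : GG.Nonempty) (hcommon : (commonBlocks GG).card < t) {s : ℕ}
    {S : BlockFamily c k} (hS : S ∈ U c k s) (hs : s ≤ t) : ¬ IsCover t GG S := by
  intro hcov
  have hsub : ∀ G ∈ GG, S ⊆ G ∧ t ≤ S.card := by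
    intro G hG
    have h1 := hcov G hG
    have h2 := Finset.card_le_card (Finset.inter_subset_right (s₁ := G) (s₂ := S))
    have h3 := card_of_mem_U hS
    refine ⟨?_, h1.trans h2⟩
    rw [← Finset.eq_of_subset_of_card_le (Finset.inter_subset_right (s₁ := G) (s₂ := S)) (by omega)]
    exact Finset.inter_subset_left
  have : S ⊆ commonBlocks GG := fun b hb =>
    Finset.mem_filter.2 ⟨Finset.mem_univ _, fun G hG => (hsub G hG).1 hb⟩
  have := Finset.card_le_card this
  obtain ⟨G, hG⟩ := hne
  have := (hsub G hG).2
  omega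

lemma exists_not_subset (hcommon : (commonBlocks GG).card < t) {T : BlockFamily c k}
    (hT : T.card = t) : ∃ G ∈ GG, ¬ T ⊆ G := by
  by_contra! h
  have := Finset.card_le_card (show T ⊆ commonBlocks GG from fun b hb =>
    Finset.mem_filter.2 ⟨Finset.mem_univ _, fun G hG => h G hG hb⟩)
  omega

end Cover

/-! ### The extremal examples -/

section Examples

variable {c k t : ℕ} {T L M Z F : BlockFamily c k}

lemma mem_N₁ : F ∈ N₁ c k t T L M ↔ F ∈ U c k k ∧
    (T ⊆ F ∧ t + 1 ≤ (F ∩ L).card ∨ ¬ T ⊆ F ∧ (F ∩ M).card = k - 2) := by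
  simp only [N₁, Finset.mem_union, Finset.mem_filter]
  tauto

lemma mem_N₂ : F ∈ N₂ c k t Z ↔ F ∈ U c k k ∧ t + 1 ≤ (F ∩ Z).card := by
  simp [N₂]

lemma mem_N₃ {A B C : BlockFamily c k} :
    F ∈ N₃ c k A B C ↔ F ∈ U c k k ∧ (A ⊆ F ∨ B ⊆ F ∨ C ⊆ F) := by
  simp [N₃]

lemma commonBlocks_eq_empty {FF : Finset (BlockFamily c k)} (h : ∀ b, ∃ F ∈ FF, b ∉ F) :
    commonBlocks FF = ∅ := by
  rw [commonBlocks, Finset.filter_eq_empty_iff]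
  intro b _ hb
  obtain ⟨F, hF, hbF⟩ := h b
  exact hbF (hb F hF)

lemma crossIntersecting_N₂ (hZ : Z ∈ U c k (t + 2)) :
    CrossIntersecting t (N₂ c k t Z) (N₂ c k t Z) := by
  intro F hF G hG
  have h1 := (mem_N₂.1 hF).2
  have h2 := (mem_N₂.1 hG).2
  have h3 := Finset.card_union_add_card_inter (F ∩ Z) (G ∩ Z)
  have h4 : (F ∩ Z ∪ G ∩ Z).card ≤ t + 2 := by
    rw [← card_of_mem_U hZ]
    exact Finset.card_le_card (Finset.union_subset Finset.inter_subset_right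
      Finset.inter_subset_right)
  have h5 : ((F ∩ Z) ∩ (G ∩ Z)).card ≤ (F ∩ G).card :=
    Finset.card_le_card (Finset.inter_subset_inter Finset.inter_subset_left
      Finset.inter_subset_left)
  omega

lemma isNontrivialCrossPair_N₂ (hc : 0 < c) (ht : 1 ≤ t) {j : ℕ} (hj : t + 1 + j = k)
    (hp : partitionCount c (j - 1) < partitionCount c j) (hZ : Z ∈ U c k (t + 2)) :
    IsNontrivialCrossPair c k t (N₂ c k t Z) (N₂ c k t Z) := by
  have hcommon : commonBlocks (N₂ c k t Z) = ∅ := by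
    refine commonBlocks_eq_empty fun b => ?_
    have hex : ∃ z ∈ Z, b ∉ Z.erase z := by
      by_cases hb : b ∈ Z
      · exact ⟨b, hb, Finset.notMem_erase _ _⟩
      · obtain ⟨z, hz⟩ := Finset.card_pos.1 (show 0 < Z.card by rw [card_of_mem_U hZ]; omega)
        exact ⟨z, hz, fun h => hb (Finset.mem_of_mem_erase h)⟩
    obtain ⟨z, hz, hbz⟩ := hex
    have hS := mem_U_of_subset hZ (Finset.erase_subset z Z)
    have hcard : (Z.erase z).card = t + 1 := by
      rw [Finset.card_erase_of_mem hz, card_of_mem_U hZ]; rfl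
    rw [hcard] at hS
    obtain ⟨F, hF, hSF, hd⟩ := exists_above_disjoint hc hS (X := {b})
      (Finset.disjoint_singleton_right.2 hbz) (by
        rw [Finset.card_singleton, one_mul, show k - (t + 1) = j by omega]; exact hp)
    refine ⟨F, mem_N₂.2 ⟨hF, ?_⟩, Finset.disjoint_singleton_right.1 hd⟩
    rw [← hcard]
    exact Finset.card_le_card (Finset.subset_inter hSF (Finset.erase_subset _ _))
  have hcard : (commonBlocks (N₂ c k t Z)).card < t := by rw [hcommon]; exact ht
  exact ⟨Finset.filter_subset _ _, Finset.filter_subset _ _, crossIntersecting_N₂ hZ, hcard, hcard⟩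

lemma card_above_sdiff_insert (hc : 0 < c) {s : ℕ} {S : BlockFamily c k} (hS : S ∈ U c k s)
    {e : Finset (Fin (c * k))} (he : insert e S ∈ U c k (s + 1)) :
    (above S \ above (insert e S)).card =
      partitionCount c (k - s) - partitionCount c (k - s - 1) := by
  rw [Finset.card_sdiff_of_subset, card_above hc hS, card_above hc he, Nat.sub_sub]
  exact fun F hF => mem_above.2 ⟨(mem_above.1 hF).1,
    (Finset.subset_insert _ _).trans (mem_above.1 hF).2⟩

lemma card_N₂_ge (hc : 0 < c) {j : ℕ} (hj : t + 1 + j = k) (hZ : Z ∈ U c k (t + 2)) :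
    (t + 2) * (partitionCount c j - partitionCount c (j - 1)) + partitionCount c (j - 1) ≤
      (N₂ c k t Z).card := by
  have hcard : ∀ z ∈ Z, (Z.erase z).card = t + 1 := fun z hz => by
    rw [Finset.card_erase_of_mem hz, card_of_mem_U hZ]; rfl
  have h1 : (Z.biUnion fun z => above (Z.erase z) \ above Z).card =
      (t + 2) * (partitionCount c j - partitionCount c (j - 1)) := by
    rw [Finset.card_biUnion, Finset.sum_congr rfl
      (g := fun _ => partitionCount c j - partitionCount c (j - 1)), Finset.sum_const,
      card_of_mem_U hZ, smul_eq_mul]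
    · intro z hz
      have hS := mem_U_of_subset hZ (Finset.erase_subset z Z)
      rw [hcard z hz] at hS
      have := card_above_sdiff_insert hc hS (e := z) (by rwa [Finset.insert_erase hz])
      rwa [Finset.insert_erase hz, show k - (t + 1) = j by omega] at this
    · intro z hz z' hz' hne
      rw [Function.onFun, Finset.disjoint_left]
      intro F hF hF'
      rw [Finset.mem_sdiff, mem_above] at hF hF'
      refine hF.2 (mem_above.2 ⟨hF.1.1, fun x hx => ?_⟩)
      by_cases hxz : x = z
      · exact hF'.1.2 (Finset.mem_erase.2 ⟨hxz ▸ hne, hx⟩)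
      · exact hF.1.2 (Finset.mem_erase.2 ⟨hxz, hx⟩)
  have h2 : (above Z).card = partitionCount c (j - 1) := by
    rw [card_above hc hZ]; congr 1; omega
  rw [← h1, ← h2, ← Finset.card_union_of_disjoint]
  · refine Finset.card_le_card (Finset.union_subset (Finset.biUnion_subset.2 fun z hz F hF => ?_)
      fun F hF => ?_)
    · obtain ⟨hFU, hsub⟩ := mem_above.1 (Finset.mem_sdiff.1 hF).1
      refine mem_N₂.2 ⟨hFU, ?_⟩
      rw [← hcard z hz]
      exact Finset.card_le_card (Finset.subset_inter hsub (Finset.erase_subset _ _))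
    · obtain ⟨hFU, hsub⟩ := mem_above.1 hF
      refine mem_N₂.2 ⟨hFU, ?_⟩
      rw [Finset.inter_eq_right.2 hsub, card_of_mem_U hZ]
      omega
  · rw [Finset.disjoint_biUnion_left]
    exact fun z _ => Finset.sdiff_disjoint

/-- A partition that meets `M` in all blocks but one, and misses a block of `T ⊆ M`, misses exactly
one block `h` of `M`, and `h ∈ T`. -/
lemma exists_erase_subset (hM : M ∈ U c k (k - 1)) (hTM : T ⊆ M) (hTF : ¬ T ⊆ F)
    (hFM : (F ∩ M).card = k - 2) : ∃ h ∈ T, h ∉ F ∧ M.erase h ⊆ F := by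
  obtain ⟨h, hT, hF⟩ := Finset.not_subset.1 hTF
  refine ⟨h, hT, hF, ?_⟩
  have h1 : F ∩ M ⊆ M.erase h := fun x hx => by
    rw [Finset.mem_inter] at hx
    exact Finset.mem_erase.2 ⟨fun e => hF (e ▸ hx.1), hx.2⟩
  have h2 := Finset.eq_of_subset_of_card_le h1 (by
    rw [hFM, Finset.card_erase_of_mem (hTM hT), card_of_mem_U hM]; omega)
  rw [← h2]
  exact Finset.inter_subset_left

lemma crossIntersecting_N₁ (hT : T ∈ U c k t) (hL : L ∈ U c k (k - 1)) (hM : M ∈ U c k (k - 1))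
    (hTL : T ⊆ L) (hTM : T ⊆ M) (hLM : t + min t 2 ≤ (L ∩ M).card) :
    CrossIntersecting t (N₁ c k t T L M) (N₁ c k t T M L) := by
  -- one member contains `T`, the other one does not
  have mixed : ∀ {L M : BlockFamily c k} (F G : BlockFamily c k), L ∈ U c k (k - 1) → T ⊆ L →
      t + 1 ≤ (F ∩ L).card → ¬ T ⊆ G → (G ∩ L).card = k - 2 → t ≤ (F ∩ G).card := by
    intro L M F G hL hTL hF hTG hG
    obtain ⟨h, hhT, hhG, hsub⟩ := exists_erase_subset hL hTL hTG hG
    have h1 : (F ∩ L).erase h ⊆ F ∩ G := fun x hx => by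
      rw [Finset.mem_erase, Finset.mem_inter] at hx
      exact Finset.mem_inter.2 ⟨hx.2.1, hsub (Finset.mem_erase.2 ⟨hx.1, hx.2.2⟩)⟩
    have := Finset.card_le_card h1
    have := Finset.pred_card_le_card_erase (s := F ∩ L) (a := h)
    omega
  intro F hF G hG
  obtain ⟨-, ⟨hF1, hF2⟩ | ⟨hF1, hF2⟩⟩ := mem_N₁.1 hF <;>
    obtain ⟨-, ⟨hG1, hG2⟩ | ⟨hG1, hG2⟩⟩ := mem_N₁.1 hG
  · rw [← card_of_mem_U hT]
    exact Finset.card_le_card (Finset.subset_inter hF1 hG1)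
  · exact mixed (M := M) F G hL hTL hF2 hG1 hG2
  · rw [Finset.inter_comm]
    exact mixed (M := L) G F hM hTM hG2 hF1 hF2
  · obtain ⟨h, hhT, hhF, hsub⟩ := exists_erase_subset hM hTM hF1 hF2
    obtain ⟨h', hhT', hhG, hsub'⟩ := exists_erase_subset hL hTL hG1 hG2
    have h1 : ((L ∩ M).erase h).erase h' ⊆ F ∩ G := fun x hx => by
      rw [Finset.mem_erase, Finset.mem_erase, Finset.mem_inter] at hx
      exact Finset.mem_inter.2 ⟨hsub (Finset.mem_erase.2 ⟨hx.2.1, hx.2.2.2⟩),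
        hsub' (Finset.mem_erase.2 ⟨hx.1, hx.2.2.1⟩)⟩
    refine le_trans ?_ (Finset.card_le_card h1)
    have h2 := Finset.pred_card_le_card_erase (s := L ∩ M) (a := h)
    have h3 := Finset.pred_card_le_card_erase (s := (L ∩ M).erase h) (a := h')
    by_cases ht : t = 1
    · have : h = h' := Finset.card_le_one.1 ((card_of_mem_U hT).trans ht).le h hhT h' hhT'
      rw [← this, Finset.erase_idem]
      omega
    · have : T.card ≠ 0 := Finset.card_ne_zero_of_mem hhT
      rw [card_of_mem_U hT] at this
      omega

lemma commonBlocks_N₁ (hc : 0 < c) (ht : 1 ≤ t) {j : ℕ} (hj : t + 1 + j = k) (hj2 : 2 ≤ j)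
    (hp : partitionCount c (j - 1) < partitionCount c j)
    (hp2 : partitionCount c 1 < partitionCount c 2)
    (hT : T ∈ U c k t) (hL : L ∈ U c k (k - 1)) (hTL : T ⊆ L) :
    commonBlocks (N₁ c k t T L L) = ∅ := by
  refine commonBlocks_eq_empty fun b => ?_
  by_cases hb : b ∈ T
  · have hcard : (L.erase b).card = k - 2 := by
      rw [Finset.card_erase_of_mem (hTL hb), card_of_mem_U hL]; omega
    have hS := mem_U_of_subset hL (Finset.erase_subset b L)
    rw [hcard] at hS
    obtain ⟨F, hF, hSF, hd⟩ := exists_above_disjoint hc hS (X := {b})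
      (Finset.disjoint_singleton_right.2 (Finset.notMem_erase _ _)) (by
        rw [Finset.card_singleton, one_mul, show k - (k - 2) = 2 by omega]; exact hp2)
    have hbF := Finset.disjoint_singleton_right.1 hd
    refine ⟨F, mem_N₁.2 ⟨hF, Or.inr ⟨fun h => hbF (h hb), ?_⟩⟩, hbF⟩
    rw [← hcard]
    congr 1
    refine Finset.Subset.antisymm (fun x hx => ?_)
      (Finset.subset_inter hSF (Finset.erase_subset _ _))
    rw [Finset.mem_inter] at hx
    exact Finset.mem_erase.2 ⟨fun e => hbF (e ▸ hx.1), hx.2⟩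
  · have h2 : 1 < (L \ T).card := by
      rw [Finset.card_sdiff_of_subset hTL, card_of_mem_U hL, card_of_mem_U hT]; omega
    obtain ⟨e, he, hne⟩ := Finset.exists_mem_ne h2 b
    rw [Finset.mem_sdiff] at he
    have hsub : insert e T ⊆ L := Finset.insert_subset he.1 hTL
    have hcard : (insert e T).card = t + 1 := by
      rw [Finset.card_insert_of_notMem he.2, card_of_mem_U hT]
    have hS := mem_U_of_subset hL hsub
    rw [hcard] at hS
    obtain ⟨F, hF, hSF, hd⟩ := exists_above_disjoint hc hS (X := {b})
      (Finset.disjoint_singleton_right.2 (by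
        rw [Finset.mem_insert]; exact fun h => h.elim (fun h => hne h.symm) hb)) (by
        rw [Finset.card_singleton, one_mul, show k - (t + 1) = j by omega]; exact hp)
    refine ⟨F, mem_N₁.2 ⟨hF, Or.inl ⟨(Finset.subset_insert _ _).trans hSF, ?_⟩⟩,
      Finset.disjoint_singleton_right.1 hd⟩
    rw [← hcard]
    exact Finset.card_le_card (Finset.subset_inter hSF hsub)

lemma isNontrivialCrossPair_N₁ (hc : 0 < c) (ht : 1 ≤ t) {j : ℕ} (hj : t + 1 + j = k)
    (hj2 : 2 ≤ j) (hp : partitionCount c (j - 1) < partitionCount c j)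
    (hp2 : partitionCount c 1 < partitionCount c 2)
    (hT : T ∈ U c k t) (hL : L ∈ U c k (k - 1)) (hTL : T ⊆ L) :
    IsNontrivialCrossPair c k t (N₁ c k t T L L) (N₁ c k t T L L) := by
  have hU : N₁ c k t T L L ⊆ U c k k := fun F hF => (mem_N₁.1 hF).1
  have hcard : (commonBlocks (N₁ c k t T L L)).card < t := by
    rw [commonBlocks_N₁ hc ht hj hj2 hp hp2 hT hL hTL]; exact ht
  refine ⟨hU, hU, crossIntersecting_N₁ hT hL hL hTL hTL ?_, hcard, hcard⟩
  rw [Finset.inter_self, card_of_mem_U hL]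
  omega

/-- Bonferroni-type lower bound, counting the partitions that contain `T` and exactly one further
block of `L`. -/
lemma card_N₁_ge (hc : 0 < c) {j : ℕ} (hj : t + 1 + j = k)
    (hT : T ∈ U c k t) (hL : L ∈ U c k (k - 1)) (hTL : T ⊆ L) :
    j * (partitionCount c j - j * partitionCount c (j - 1)) ≤ (N₁ c k t T L M).card := by
  have hE : (L \ T).card = j := by
    rw [Finset.card_sdiff_of_subset hTL, card_of_mem_U hL, card_of_mem_U hT]; omega
  have hsub : ∀ e ∈ L \ T, insert e T ⊆ L := fun e he =>
    Finset.insert_subset (Finset.mem_sdiff.1 he).1 hTL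
  have hcard : ∀ e ∈ L \ T, (insert e T).card = t + 1 := fun e he => by
    rw [Finset.card_insert_of_notMem (Finset.mem_sdiff.1 he).2, card_of_mem_U hT]
  set P : Finset (Fin (c * k)) → Finset (BlockFamily c k) := fun e =>
    above (insert e T) \ ((L \ T).erase e).biUnion fun e' => above (insert e' (insert e T)) with hP
  have hPcard : ∀ e ∈ L \ T, partitionCount c j - j * partitionCount c (j - 1) ≤ (P e).card := by
    intro e he
    have hS := mem_U_of_subset hL (hsub e he)
    rw [hcard e he] at hS
    have h1 := card_above hc hS
    rw [show k - (t + 1) = j by omega] at h1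
    have h2 := Finset.card_biUnion_le_card_mul ((L \ T).erase e)
      (fun e' => above (insert e' (insert e T))) (partitionCount c (j - 1)) (by
        intro e' he'
        have := card_above_insert_le hc hS (b := e') (by
          rw [Finset.mem_erase, Finset.mem_sdiff] at he'
          rw [Finset.mem_insert]
          tauto)
        rwa [show k - (t + 1) = j by omega] at this)
    have h3 : ((L \ T).erase e).card * partitionCount c (j - 1) ≤ j * partitionCount c (j - 1) :=
      Nat.mul_le_mul_right _ ((Finset.card_erase_le).trans hE.le)
    have h4 := Finset.le_card_sdiff
      (((L \ T).erase e).biUnion fun e' => above (insert e' (insert e T))) (above (insert e T))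
    simp only [hP]
    omega
  have hdisj : ∀ e ∈ L \ T, ∀ e' ∈ L \ T, e ≠ e' → Disjoint (P e) (P e') := by
    intro e he e' he' hne
    rw [Finset.disjoint_left]
    intro F hF hF'
    simp only [hP, Finset.mem_sdiff (s := above _), mem_above, Finset.mem_biUnion] at hF hF'
    exact hF.2 ⟨e', Finset.mem_erase.2 ⟨hne.symm, he'⟩, hF.1.1, Finset.insert_subset
      (hF'.1.2 (Finset.mem_insert_self _ _)) hF.1.2⟩
  calc _ = ∑ e ∈ L \ T, (partitionCount c j - j * partitionCount c (j - 1)) := by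
        rw [Finset.sum_const, hE, smul_eq_mul]
    _ ≤ ∑ e ∈ L \ T, (P e).card := Finset.sum_le_sum hPcard
    _ = ((L \ T).biUnion P).card := (Finset.card_biUnion hdisj).symm
    _ ≤ _ := Finset.card_le_card (Finset.biUnion_subset.2 fun e he F hF => by
        obtain ⟨hFU, hS⟩ := mem_above.1 (Finset.mem_sdiff.1 hF).1
        refine mem_N₁.2 ⟨hFU, Or.inl ⟨(Finset.subset_insert _ _).trans hS, ?_⟩⟩
        rw [← hcard e he]
        exact Finset.card_le_card (Finset.subset_inter hS (hsub e he)))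

/-- The number of members of `N₁ T L M` that do not contain `T`. -/
lemma card_N₁_not_superset (hc : 0 < c) (hk : t + 3 ≤ k) (hT : T ∈ U c k t)
    (hM : M ∈ U c k (k - 1)) (hTM : T ⊆ M) :
    ((U c k k).filter fun F => ¬ T ⊆ F ∧ (F ∩ M).card = k - 2).card =
      t * (partitionCount c 2 - partitionCount c 1) := by
  have heq : ((U c k k).filter fun F => ¬ T ⊆ F ∧ (F ∩ M).card = k - 2) =
      T.biUnion fun h => above (M.erase h) \ above M := by
    ext F
    simp only [Finset.mem_filter, Finset.mem_biUnion, Finset.mem_sdiff, mem_above]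
    constructor
    · rintro ⟨hF, hTF, hFM⟩
      obtain ⟨h, hhT, hhF, hsub⟩ := exists_erase_subset hM hTM hTF hFM
      exact ⟨h, hhT, ⟨hF, hsub⟩, fun h' => hhF (h'.2 (hTM hhT))⟩
    · rintro ⟨h, hhT, ⟨hF, hsub⟩, hn⟩
      have hhF : h ∉ F := fun hhF => hn ⟨hF, fun x hx => by
        by_cases hxh : x = h
        · exact hxh ▸ hhF
        · exact hsub (Finset.mem_erase.2 ⟨hxh, hx⟩)⟩
      refine ⟨hF, fun h' => hhF (h' hhT), ?_⟩
      have : F ∩ M = M.erase h := by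
        refine Finset.Subset.antisymm (fun x hx => ?_)
          (Finset.subset_inter hsub (Finset.erase_subset _ _))
        rw [Finset.mem_inter] at hx
        exact Finset.mem_erase.2 ⟨fun e => hhF (e ▸ hx.1), hx.2⟩
      rw [this, Finset.card_erase_of_mem (hTM hhT), card_of_mem_U hM]
      omega
  rw [heq, Finset.card_biUnion, Finset.sum_congr rfl
      (g := fun _ => partitionCount c 2 - partitionCount c 1), Finset.sum_const,
      card_of_mem_U hT, smul_eq_mul]
  · intro h hh
    have hS := mem_U_of_subset hM (Finset.erase_subset h M)
    rw [Finset.card_erase_of_mem (hTM hh), card_of_mem_U hM] at hS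
    have := card_above_sdiff_insert hc hS (e := h) (by
      rw [Finset.insert_erase (hTM hh)]; convert hM using 2; omega)
    rwa [Finset.insert_erase (hTM hh), show k - (k - 1 - 1) = 2 by omega] at this
  · intro h hh h' hh' hne
    rw [Function.onFun, Finset.disjoint_left]
    intro F hF hF'
    rw [Finset.mem_sdiff, mem_above] at hF hF'
    refine hF.2 (mem_above.2 ⟨hF.1.1, fun x hx => ?_⟩)
    by_cases hxz : x = h
    · exact hF'.1.2 (Finset.mem_erase.2 ⟨hxz ▸ hne, hx⟩)
    · exact hF.1.2 (Finset.mem_erase.2 ⟨hxz, hx⟩)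

lemma card_N₁ (hc : 0 < c) (hk : t + 3 ≤ k) (hT : T ∈ U c k t)
    (hM : M ∈ U c k (k - 1)) (hTM : T ⊆ M) :
    (N₁ c k t T L M).card = ((U c k k).filter fun F => T ⊆ F ∧ t + 1 ≤ (F ∩ L).card).card +
      t * (partitionCount c 2 - partitionCount c 1) := by
  rw [N₁, Finset.card_union_of_disjoint, card_N₁_not_superset hc hk hT hM hTM]
  rw [Finset.disjoint_filter]
  tauto

/-- Upper bound for the number of partitions that contain `T` and a further block of `L`; the
partitions containing one of two fixed blocks of `L` are counted first. -/
lemma card_superset_inter_le (hc : 0 < c) {j : ℕ} (hj : t + 1 + j = k) (hj2 : 2 ≤ j)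
    (hT : T ∈ U c k t) (hL : L ∈ U c k (k - 1)) (hTL : T ⊆ L) :
    ((U c k k).filter fun F => T ⊆ F ∧ t + 1 ≤ (F ∩ L).card).card +
        (2 * (j - 2) + 1) * partitionCount c (j - 1) ≤
      j * partitionCount c j + (j - 2) * partitionCount c (j - 2) := by
  have hE : (L \ T).card = j := by
    rw [Finset.card_sdiff_of_subset hTL, card_of_mem_U hL, card_of_mem_U hT]; omega
  obtain ⟨D, hD, hDc⟩ := Finset.exists_subset_card_eq (hj2.trans_eq hE.symm)
  obtain ⟨x, y, hxy, rfl⟩ := Finset.card_eq_two.1 hDc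
  have count : ∀ A ⊆ L \ T, (above (A ∪ T)).card = partitionCount c (j + 1 - A.card) := by
    intro A hA
    have hd : Disjoint A T := Finset.disjoint_of_subset_left hA Finset.sdiff_disjoint
    have hU := mem_U_of_subset hL (Finset.union_subset (hA.trans Finset.sdiff_subset) hTL)
    rw [card_above hc hU, Finset.card_union_of_disjoint hd, card_of_mem_U hT]
    congr 1; omega
  have hx : x ∈ L \ T := hD (by simp)
  have hy : y ∈ L \ T := hD (by simp)
  have hinter : ∀ A B : BlockFamily c k, above (A ∪ T) ∩ above (B ∪ T) = above (A ∪ B ∪ T) := by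
    intro A B
    ext F
    simp only [Finset.mem_inter, mem_above, Finset.union_subset_iff]
    tauto
  set X := above ({x} ∪ T) ∪ above ({y} ∪ T) with hX
  have hXc : X.card + partitionCount c (j - 1) = 2 * partitionCount c j := by
    have h := Finset.card_union_add_card_inter (above ({x} ∪ T)) (above ({y} ∪ T))
    have hpair : ({x} ∪ {y} : BlockFamily c k) = {x, y} := rfl
    rw [← hX, hinter, count _ (Finset.singleton_subset_iff.2 hx),
      count _ (Finset.singleton_subset_iff.2 hy), hpair, count _ hD, Finset.card_singleton,
      Finset.card_singleton, hDc, show j + 1 - 2 = j - 1 by omega, Nat.add_sub_cancel] at h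
    omega
  have hz : ∀ z ∈ (L \ T) \ {x, y}, (above ({z} ∪ T) \ X).card +
      2 * partitionCount c (j - 1) ≤ partitionCount c j + partitionCount c (j - 2) := by
    intro z hz
    rw [Finset.mem_sdiff, Finset.mem_insert, Finset.mem_singleton, not_or] at hz
    have h1 := Finset.card_sdiff_add_card_inter (above ({z} ∪ T)) X
    have h2 : above ({z} ∪ T) ∩ X = above ({z, x} ∪ T) ∪ above ({z, y} ∪ T) := by
      rw [hX, Finset.inter_union_distrib_left, hinter, hinter, ← Finset.insert_eq,
        ← Finset.insert_eq]
    have hzx : ({z, x} : BlockFamily c k) ⊆ L \ T := by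
      simp only [Finset.insert_subset_iff, Finset.singleton_subset_iff]; exact ⟨hz.1, hx⟩
    have hzy : ({z, y} : BlockFamily c k) ⊆ L \ T := by
      simp only [Finset.insert_subset_iff, Finset.singleton_subset_iff]; exact ⟨hz.1, hy⟩
    have h3 := Finset.card_union_add_card_inter (above ({z, x} ∪ T)) (above ({z, y} ∪ T))
    have h4 : ({z, x} ∪ {z, y} : BlockFamily c k) = {z, x, y} := by
      ext; simp
    rw [hinter, h4, count _ hzx, count _ hzy, count, Finset.card_pair hz.2.1,
      Finset.card_pair hz.2.2, Finset.card_eq_three.2 ⟨z, x, y, hz.2.1, hz.2.2, hxy, rfl⟩,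
      show j + 1 - 2 = j - 1 by omega, show j + 1 - 3 = j - 2 by omega] at h3
    · rw [h2, count _ (Finset.singleton_subset_iff.2 hz.1),
        Finset.card_singleton, Nat.add_sub_cancel] at h1
      omega
    · simp only [Finset.insert_subset_iff, Finset.singleton_subset_iff]; exact ⟨hz.1, hx, hy⟩
  have hsub : ((U c k k).filter fun F => T ⊆ F ∧ t + 1 ≤ (F ∩ L).card) ⊆
      X ∪ ((L \ T) \ {x, y}).biUnion fun z => above ({z} ∪ T) \ X := by
    intro F hF
    obtain ⟨hFU, hTF, hFL⟩ := Finset.mem_filter.1 hF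
    have : ∃ z ∈ F ∩ L, z ∉ T := by
      by_contra! h
      have := Finset.card_le_card (show F ∩ L ⊆ T from h)
      rw [card_of_mem_U hT] at this
      omega
    obtain ⟨z, hz, hzT⟩ := this
    rw [Finset.mem_inter] at hz
    have hab : F ∈ above ({z} ∪ T) :=
      mem_above.2 ⟨hFU, Finset.union_subset (by simpa using hz.1) hTF⟩
    by_cases hFX : F ∈ X
    · exact Finset.mem_union_left _ hFX
    · refine Finset.mem_union_right _ (Finset.mem_biUnion.2 ⟨z, ?_, Finset.mem_sdiff.2 ⟨hab, hFX⟩⟩)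
      simp only [Finset.mem_sdiff, Finset.mem_insert, Finset.mem_singleton, not_or]
      refine ⟨⟨hz.2, hzT⟩, ?_, ?_⟩
      · rintro rfl; exact hFX (Finset.mem_union_left _ hab)
      · rintro rfl; exact hFX (Finset.mem_union_right _ hab)
  have h1 := (Finset.card_le_card hsub).trans (Finset.card_union_le _ _)
  have h2 := Finset.card_biUnion_le (s := (L \ T) \ {x, y}) (t := fun z => above ({z} ∪ T) \ X)
  have h3 := Finset.sum_le_card_nsmul _ _ _ hz
  rw [Finset.sum_add_distrib, Finset.sum_const, Finset.card_sdiff_of_subset hD, hE, hDc,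
    smul_eq_mul, smul_eq_mul] at h3
  obtain ⟨i, rfl⟩ : ∃ i, j = i + 2 := ⟨j - 2, by omega⟩
  simp only [Nat.add_sub_cancel] at *
  nlinarith

end Examples

/-! ### Numerical estimates -/

section Estimates

variable {c t j m : ℕ}

lemma seven_mul_pow_five_le_choose (hj : 3 ≤ j) : 7 * j ^ 5 ≤ (6 * j - 1).choose 5 := by
  have h := Nat.descFactorial_eq_factorial_mul_choose (6 * j - 1) 5
  have h2 : (4 * j) ^ 5 ≤ (6 * j - 1).descFactorial 5 :=
    (Nat.pow_le_pow_left (by omega : 4 * j ≤ 6 * j - 1 + 1 - 5) 5).trans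
      (Nat.pow_sub_le_descFactorial _ _)
  rw [h, show Nat.factorial 5 = 120 by rfl, mul_pow] at h2
  omega

lemma seven_mul_pow_five_le_blockRatio (hc : 6 ≤ c) (hj : 3 ≤ j) : 7 * j ^ 5 ≤ blockRatio c j :=
  (seven_mul_pow_five_le_choose hj).trans
    (blockRatio_le_of_le_left (c := 6) (by norm_num) (by omega) hc)

lemma two_mul_sq_le_blockRatio (hc : 6 ≤ c) {i : ℕ} (hi : 2 ≤ i) : 2 * i ^ 2 ≤ blockRatio c i := by
  rcases hi.eq_or_lt with rfl | h
  · refine le_trans ?_ (blockRatio_le_of_le_left (c := 6) (by norm_num) (by norm_num) hc)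
    decide
  · refine le_trans ?_ (seven_mul_pow_five_le_blockRatio hc h)
    exact Nat.mul_le_mul (by norm_num) (Nat.pow_le_pow_right (by omega) (by norm_num))

/-- `blockRatio c 2` is half the central binomial coefficient of `c`, so it at least triples with
each step of `c`. -/
lemma three_pow_le_blockRatio_two (d : ℕ) : 1716 * 3 ^ d ≤ blockRatio (7 + d) 2 := by
  induction d with
  | zero => decide
  | succ d ih =>
    have h : ∀ e, blockRatio (e + 1) 2 * 2 = Nat.centralBinom (e + 1) := by
      intro e
      rw [blockRatio, Nat.centralBinom_eq_two_mul_choose, show 2 * (e + 1) = 2 * e + 1 + 1 by ring,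
        Nat.choose_succ_succ, show (e + 1) * 2 - 1 = 2 * e + 1 by omega, Nat.add_sub_cancel,
        ← Nat.choose_symm_half e]
      ring
    have h1 := h (6 + d)
    have h2 := h (7 + d)
    have h3 := Nat.succ_mul_centralBinom_succ (7 + d)
    rw [show 6 + d + 1 = 7 + d by ring] at h1
    rw [show 7 + (d + 1) = 7 + d + 1 by ring]
    rw [← h1, ← h2] at h3
    have h4 : 3 * blockRatio (7 + d) 2 ≤ blockRatio (7 + d + 1) 2 := by
      by_contra hcon
      push Not at hcon
      nlinarith
    rw [pow_succ]
    omega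

lemma pow_six_le_blockRatio {i : ℕ} (hc : 7 ≤ c) (ht : t ^ 4 ≤ 2 ^ (c - 7)) (hi : 2 ≤ i) :
    1716 * t ^ 6 ≤ blockRatio c i := by
  obtain ⟨d, rfl⟩ : ∃ d, c = 7 + d := ⟨c - 7, by omega⟩
  rw [Nat.add_sub_cancel_left] at ht
  refine le_trans ?_ ((three_pow_le_blockRatio_two d).trans (blockRatio_mono hi))
  refine Nat.mul_le_mul_left _ ?_
  rw [← Nat.pow_le_pow_iff_left (two_ne_zero)]
  calc (t ^ 6) ^ 2 = (t ^ 4) ^ 3 := by ring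
    _ ≤ (2 ^ d) ^ 3 := Nat.pow_le_pow_left ht 3
    _ = 8 ^ d := by rw [← pow_mul, mul_comm, pow_mul]; norm_num
    _ ≤ 9 ^ d := Nat.pow_le_pow_left (by norm_num) d
    _ = (3 ^ d) ^ 2 := by rw [← pow_mul, mul_comm d, pow_mul]; norm_num

lemma pow_four_le_of_logb (ht : 1 ≤ t) (h : 4 * Real.logb 2 (t : ℝ) + 7 ≤ (c : ℝ)) :
    7 ≤ c ∧ t ^ 4 ≤ 2 ^ (c - 7) := by
  have h0 : 0 ≤ Real.logb 2 (t : ℝ) :=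
    Real.logb_nonneg (by norm_num) (by exact_mod_cast ht)
  have hc : 7 ≤ c := by
    have : (7 : ℝ) ≤ c := by linarith
    exact_mod_cast this
  refine ⟨hc, ?_⟩
  have ht0 : (0 : ℝ) < t := by exact_mod_cast ht
  have h1 : Real.logb 2 ((t : ℝ) ^ 4) ≤ ((c - 7 : ℕ) : ℝ) := by
    rw [Real.logb_pow, Nat.cast_sub hc]
    push_cast
    linarith
  rw [Real.logb_le_iff_le_rpow (by norm_num) (by positivity), Real.rpow_natCast] at h1
  exact_mod_cast h1

/-- The growth of `partitionCount` under either hypothesis on `c`, `k = t + 1 + j` and `t`. The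
first estimate compares leading terms with error terms; the second one says that
`coverWeight c t j d` does not increase with `d`, except in the step to `d = j`. -/
lemma growth_estimates (ht : 1 ≤ t) (hc : 6 ≤ c) (hj : 2 ≤ j)
    (h : 4 * Real.logb 2 (t : ℝ) + 7 ≤ (c : ℝ) ∨ t + 2 ≤ j) :
    7 * (max (t + 2) j) ^ 5 ≤ blockRatio c j ∧
      ∀ i d, 2 ≤ i → 1 ≤ d → i + d = j → (t + d + 2) * i ≤ blockRatio c i * (d + 2) := by
  by_cases htj : t + 2 ≤ j
  · rw [max_eq_right htj]
    refine ⟨seven_mul_pow_five_le_blockRatio hc (by omega), fun i d hi hd hid => ?_⟩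
    have h1 := two_mul_sq_le_blockRatio hc hi
    calc (t + d + 2) * i ≤ (i + 2 * d) * i := Nat.mul_le_mul_right _ (by omega)
      _ ≤ (2 * i * (d + 2)) * i := Nat.mul_le_mul_right _ (by nlinarith)
      _ = 2 * i ^ 2 * (d + 2) := by ring
      _ ≤ _ := Nat.mul_le_mul_right _ h1
  · obtain ⟨hc7, ht4⟩ := pow_four_le_of_logb ht (h.resolve_right htj)
    rw [max_eq_left (by omega)]
    constructor
    · refine le_trans ?_ (pow_six_le_blockRatio hc7 ht4 hj)
      -- for `t = 1` this reads `1701 ≤ 1716`, so `7` is the largest integer that works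
      rcases ht.eq_or_lt with rfl | ht2
      · norm_num
      · calc 7 * (t + 2) ^ 5 ≤ 7 * (2 * t) ^ 5 := by gcongr; omega
          _ = 224 * t ^ 5 := by ring
          _ ≤ 1716 * t ^ 6 := Nat.mul_le_mul (by norm_num) (Nat.pow_le_pow_right ht (by norm_num))
    · intro i d hi hd hid
      have h1 := pow_six_le_blockRatio hc7 ht4 hi
      have h2 : t ^ 2 ≤ t ^ 6 := Nat.pow_le_pow_right ht (by norm_num)
      calc (t + d + 2) * i ≤ (1716 * t ^ 2) * 1 := by nlinarith
        _ ≤ blockRatio c i * (d + 2) := Nat.mul_le_mul (by omega) (by omega)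

/-- The contribution of a family whose smallest cover has `t + 1 + d` blocks to the bound on the
product of the two family sizes, when `k = t + 1 + j`. -/
def coverWeight (c t j d : ℕ) : ℕ :=
  (t + 1 + d).choose t * ((j + 1).descFactorial (d + 1) * partitionCount c (j - d))

lemma coverWeight_zero : coverWeight c t j 0 = (t + 1) * (j + 1) * partitionCount c j := by
  simp [coverWeight, mul_assoc]

lemma coverWeight_succ {d i : ℕ} (h : d + (i + 1) = j) :
    coverWeight c t j (d + 1) * ((d + 2) * blockRatio c (i + 1)) =
      (t + d + 2) * (i + 1) * coverWeight c t j d := by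
  have h1 : (t + 1 + (d + 1)).choose t * (d + 2) = (t + 1 + d).choose t * (t + d + 2) := by
    have := Nat.choose_mul_succ_eq (t + 1 + d) t
    rw [show t + 1 + d + 1 - t = d + 2 by omega] at this
    rw [show t + 1 + (d + 1) = t + 1 + d + 1 by ring, ← this]
    ring
  have h2 : (j + 1).descFactorial (d + 1 + 1) = (i + 1) * (j + 1).descFactorial (d + 1) := by
    rw [Nat.descFactorial_succ, show j + 1 - (d + 1) = i + 1 by omega]
  rw [coverWeight, coverWeight, h2, show j - (d + 1) = i by omega, show j - d = i + 1 by omega,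
    partitionCount_succ]
  calc _ = ((t + 1 + (d + 1)).choose t * (d + 2)) * ((i + 1) * (j + 1).descFactorial (d + 1) *
        partitionCount c i * blockRatio c (i + 1)) := by ring
    _ = _ := by rw [h1]; ring

lemma two_mul_coverWeight_le (ht : 1 ≤ t) (hj : 2 ≤ j) (hm : m = max (t + 2) j)
    (h1 : 7 * m ^ 5 ≤ blockRatio c j)
    (h2 : ∀ i d, 2 ≤ i → 1 ≤ d → i + d = j → (t + d + 2) * i ≤ blockRatio c i * (d + 2))
    {d : ℕ} (hd : 1 ≤ d) (hdj : d ≤ j) : 2 * coverWeight c t j d ≤ partitionCount c j := by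
  -- the factor `t + 2` pays for the last step, where `partitionCount` does not grow
  have main : ∀ d, 1 ≤ d → d < j → (t + 2) * coverWeight c t j d ≤ partitionCount c j := by
    intro d hd
    induction d, hd using Nat.le_induction with
    | base =>
      intro _
      obtain ⟨i, rfl⟩ : ∃ i, j = i + 1 := ⟨j - 1, by omega⟩
      have hs := coverWeight_succ (c := c) (t := t) (j := i + 1) (d := 0) (i := i) (by omega)
      rw [coverWeight_zero] at hs
      have hr : 0 < blockRatio c (i + 1) := blockRatio_pos i.succ_pos
      have hmt : t + 2 ≤ m := hm ▸ le_max_left _ _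
      have hmj : i + 1 ≤ m := hm ▸ le_max_right _ _
      have h3 : (t + 2) * ((t + 2) * (i + 1) * ((t + 1) * (i + 1 + 1))) ≤
          2 * blockRatio c (i + 1) := by
        calc (t + 2) * ((t + 2) * (i + 1) * ((t + 1) * (i + 1 + 1)))
            ≤ m * (m * m * (m * (m + 1))) := by
              gcongr
              omega
          _ ≤ 2 * (7 * m ^ 5) := by
            have : 1 ≤ m := by omega
            calc m * (m * m * (m * (m + 1))) ≤ m * (m * m * (m * (m + m))) := by gcongr
              _ ≤ 2 * (7 * m ^ 5) := by
                have : m * (m * m * (m * (m + m))) = 2 * m ^ 5 := by ring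
                omega
          _ ≤ _ := Nat.mul_le_mul_left _ h1
      refine Nat.le_of_mul_le_mul_right ?_ (Nat.mul_pos two_pos hr)
      calc (t + 2) * coverWeight c t (i + 1) 1 * (2 * blockRatio c (i + 1))
          = (t + 2) * ((t + 2) * (i + 1) * ((t + 1) * (i + 1 + 1))) *
              partitionCount c (i + 1) := by
            have : coverWeight c t (i + 1) 1 * (2 * blockRatio c (i + 1)) = _ := hs
            rw [mul_assoc, this]; ring
        _ ≤ 2 * blockRatio c (i + 1) * partitionCount c (i + 1) := Nat.mul_le_mul_right _ h3
        _ = _ := by ring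
    | succ d hd ih =>
      intro hdj
      obtain ⟨i, hi⟩ : ∃ i, d + (i + 1) = j := ⟨j - d - 1, by omega⟩
      have hs := coverWeight_succ (c := c) (t := t) hi
      refine le_trans (Nat.mul_le_mul_left _ ?_) (ih (by omega))
      have hr : 0 < blockRatio c (i + 1) := blockRatio_pos i.succ_pos
      refine Nat.le_of_mul_le_mul_right ?_ (Nat.mul_pos (Nat.succ_pos (d + 1)) hr)
      rw [hs, mul_comm (coverWeight c t j d)]
      refine Nat.mul_le_mul_right _ ?_
      rw [mul_comm (d + 1).succ]
      exact h2 (i + 1) d (by omega) hd (by omega)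
  rcases hdj.eq_or_lt with rfl | hlt
  · obtain ⟨e, rfl⟩ : ∃ e, d = e + 1 := ⟨d - 1, by omega⟩
    have h3 := main e (by omega) (by omega)
    have hs := coverWeight_succ (c := c) (t := t) (d := e) (i := 0) rfl
    rw [zero_add, blockRatio_one, mul_one, mul_one] at hs
    refine Nat.le_of_mul_le_mul_right ?_ (Nat.succ_pos (e + 1))
    calc 2 * coverWeight c t (e + 1) (e + 1) * (e + 2)
        = 2 * (t + e + 2) * coverWeight c t (e + 1) e := by rw [mul_assoc, hs]; ring
      _ ≤ (t + 2) * (e + 2) * coverWeight c t (e + 1) e := Nat.mul_le_mul_right _ (by nlinarith)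
      _ = (t + 2) * coverWeight c t (e + 1) e * (e + 2) := by ring
      _ ≤ _ := Nat.mul_le_mul_right _ h3
  · exact (Nat.mul_le_mul_right _ (by omega)).trans (main d hd hlt)

/-- A pair in which one family has no cover of `t + 1` blocks is far from optimal. -/
lemma mul_lt_sq_of_half {P q N x y : ℕ} (hm : m = max (t + 2) j) (hP : 7 * m ^ 5 * q ≤ P)
    (hq : 0 < q) (hN : m * (P - m * q) ≤ N)
    (hx : x ≤ (t + 1) * (j + 1) * P ∨ 2 * x ≤ P) (hy : 2 * y ≤ P) : x * y < N * N := by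
  have hmt : t + 2 ≤ m := hm ▸ le_max_left _ _
  have hmj : j ≤ m := hm ▸ le_max_right _ _
  have hx' : x ≤ m ^ 2 * P := by
    rcases hx with h | h
    · refine h.trans (Nat.mul_le_mul_right _ ?_)
      calc (t + 1) * (j + 1) ≤ (m - 1) * (m + 1) := Nat.mul_le_mul (by omega) (by omega)
        _ ≤ m ^ 2 := by
          obtain ⟨n, rfl⟩ : ∃ n, m = n + 1 := ⟨m - 1, by omega⟩
          rw [Nat.add_sub_cancel]; nlinarith
    · have : 1 ≤ m ^ 2 := Nat.one_le_pow _ _ (by omega)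
      nlinarith
  have hP7 : 7 * (m * q) ≤ P := by
    refine le_trans ?_ hP
    have : m ≤ m ^ 5 := Nat.le_self_pow (by norm_num) m
    nlinarith
  have hP0 : 0 < P := by
    have : 0 < m * q := Nat.mul_pos (by omega) hq
    omega
  have hN' : 6 * (m * P) ≤ 7 * N := by
    have : 6 * P ≤ 7 * (P - m * q) := by omega
    nlinarith
  have h1 : 2 * (x * y) ≤ m ^ 2 * P ^ 2 := by nlinarith
  have h2 : 36 * (m ^ 2 * P ^ 2) ≤ 49 * (N * N) := by
    calc 36 * (m ^ 2 * P ^ 2) = (6 * (m * P)) * (6 * (m * P)) := by ring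
      _ ≤ (7 * N) * (7 * N) := Nat.mul_le_mul hN' hN'
      _ = _ := by ring
  have h3 : 0 < m ^ 2 * P ^ 2 := by
    have : 0 < m := by omega
    positivity
  omega

lemma mul_self_le_of_le_add {N u w : ℕ} (h : u ≤ N + w) : u * u ≤ N * N + 2 * (u * w) := by
  rcases le_total N u with h' | h'
  · calc u * u ≤ u * (N + w) := Nat.mul_le_mul_left u h
      _ = u * N + u * w := by ring
      _ ≤ (N + w) * N + u * w := by gcongr
      _ = N * N + N * w + u * w := by ring
      _ ≤ N * N + u * w + u * w := by gcongr
      _ = _ := by ring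
  · exact (Nat.mul_le_mul h' h').trans (Nat.le_add_right _ _)

/-- A pair whose families have `f` and `g` covers of `t + 1` blocks with `f * g < m ^ 2` is
smaller than a pair with `m ^ 2`, as the leading terms differ by more than the error terms. -/
lemma mul_lt_sq_of_main_term {P q N x y f g : ℕ} (hm : m = max (t + 2) j) (ht : 1 ≤ t)
    (hP : 7 * m ^ 5 * q ≤ P) (hq : 0 < q) (hN : m * (P - m * q) ≤ N)
    (hf : 0 < f) (hg : 0 < g) (hfg : f * g < m ^ 2)
    (hx : x ≤ f * P + (t + 1) * ((j + 1) * (j * q)))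
    (hy : y ≤ g * P + (t + 1) * ((j + 1) * (j * q))) : x * y < N * N := by
  have hmt : t + 2 ≤ m := hm ▸ le_max_left _ _
  have hmj : j ≤ m := hm ▸ le_max_right _ _
  have hm3 : 3 ≤ m := by omega
  set e := m ^ 3 * q with he
  have herr : (t + 1) * ((j + 1) * (j * q)) ≤ e := by
    calc (t + 1) * ((j + 1) * (j * q)) = ((t + 1) * (j + 1)) * (j * q) := by ring
      _ ≤ (m ^ 2) * (m * q) := by
        refine Nat.mul_le_mul ?_ (Nat.mul_le_mul_right _ hmj)
        obtain ⟨n, rfl⟩ : ∃ n, m = n + 1 := ⟨m - 1, by omega⟩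
        calc (t + 1) * (j + 1) ≤ n * (n + 2) := Nat.mul_le_mul (by omega) (by omega)
          _ ≤ (n + 1) ^ 2 := by nlinarith
      _ = e := by rw [he]; ring
  have he7 : 7 * m ^ 2 * e ≤ P := by
    refine le_trans (le_of_eq ?_) hP
    rw [he]; ring
  have hm9 : 9 ≤ m ^ 2 := by nlinarith
  have he63 : 63 * e ≤ P := by nlinarith
  have hmq : m * q ≤ P := by
    have : m * q ≤ e := by
      rw [he]; exact Nat.mul_le_mul_right _ (Nat.le_self_pow (by norm_num) m)
    omega
  have hP0 : 0 < P := by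
    have : 0 < m * q := Nat.mul_pos (by omega) hq
    omega
  have hfg' : f + g ≤ m ^ 2 := by nlinarith
  have hup : x * y ≤ f * g * P ^ 2 + (f + g) * e * P + e ^ 2 := by
    calc x * y ≤ (f * P + e) * (g * P + e) := Nat.mul_le_mul (by omega) (by omega)
      _ = _ := by ring
  have hA : f * g * P ^ 2 + P ^ 2 ≤ m ^ 2 * P ^ 2 := by
    rw [← Nat.succ_mul]
    exact Nat.mul_le_mul_right _ hfg
  have hB : 7 * ((f + g) * e * P) ≤ P ^ 2 := by
    calc 7 * ((f + g) * e * P) ≤ 7 * (m ^ 2 * e * P) := by gcongr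
      _ = 7 * m ^ 2 * e * P := by ring
      _ ≤ P * P := Nat.mul_le_mul_right _ he7
      _ = P ^ 2 := by ring
  have hC : 63 * e ^ 2 ≤ P ^ 2 := by
    calc 63 * e ^ 2 = (63 * e) * e := by ring
      _ ≤ P * P := Nat.mul_le_mul he63 (by omega)
      _ = P ^ 2 := by ring
  have hlow : m ^ 2 * P ^ 2 ≤ N * N + 2 * e * P := by
    have h1 : m * P ≤ N + m ^ 2 * q := by
      have : m * (P - m * q) + m * (m * q) = m * P := by
        rw [← Nat.mul_add, Nat.sub_add_cancel hmq]
      rw [← this, show m ^ 2 * q = m * (m * q) by ring]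
      exact Nat.add_le_add_right hN _
    calc m ^ 2 * P ^ 2 = (m * P) * (m * P) := by ring
      _ ≤ N * N + 2 * ((m * P) * (m ^ 2 * q)) := mul_self_le_of_le_add h1
      _ = N * N + 2 * e * P := by rw [he]; ring
  have hD : 63 * (2 * e * P) ≤ 2 * P ^ 2 := by
    calc 63 * (2 * e * P) = 2 * ((63 * e) * P) := by ring
      _ ≤ 2 * (P * P) := Nat.mul_le_mul_left _ (Nat.mul_le_mul_right _ he63)
      _ = 2 * P ^ 2 := by ring
  have : 0 < P ^ 2 := by positivity
  omega

end Estimates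

/-! ### Cross intersecting families of `(t + 1)`-sets -/

section SetFamilies

variable {β : Type*} [DecidableEq β] {t j m : ℕ}

/-- A family of `(t + 1)`-sets that pairwise share at least `t` elements is a star or lies inside a
set of `t + 2` elements. -/
lemma exists_kernel_or_hull {C : Finset (Finset β)} (hne : C.Nonempty)
    (hcard : ∀ A ∈ C, A.card = t + 1) (hint : ∀ A ∈ C, ∀ B ∈ C, t ≤ (A ∩ B).card) :
    (∃ T : Finset β, T.card = t ∧ ∀ A ∈ C, T ⊆ A) ∨
      ∃ Z : Finset β, Z.card = t + 2 ∧ ∀ A ∈ C, A ⊆ Z := by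
  by_cases hall : ∀ A ∈ C, ∀ B ∈ C, A = B
  · obtain ⟨A, hA⟩ := hne
    obtain ⟨T, hTA, hT⟩ := Finset.exists_subset_card_eq (s := A) (n := t)
      (by rw [hcard A hA]; omega)
    exact Or.inl ⟨T, hT, fun B hB => hall A hA B hB ▸ hTA⟩
  · push Not at hall
    obtain ⟨A, hA, B, hB, hAB⟩ := hall
    have hlt : (A ∩ B).card < t + 1 := by
      rw [← hcard A hA]
      refine Finset.card_lt_card ⟨Finset.inter_subset_left, fun h => hAB ?_⟩
      exact Finset.eq_of_subset_of_card_le (fun x hx => (Finset.mem_inter.1 (h hx)).2)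
        (by rw [hcard A hA, hcard B hB])
    have hT : (A ∩ B).card = t := le_antisymm (by omega) (hint A hA B hB)
    have hZ : (A ∪ B).card = t + 2 := by
      have := Finset.card_union_add_card_inter A B
      rw [hcard A hA, hcard B hB] at this; omega
    by_cases hstar : ∀ D ∈ C, A ∩ B ⊆ D
    · exact Or.inl ⟨_, hT, hstar⟩
    · refine Or.inr ⟨_, hZ, ?_⟩
      push Not at hstar
      obtain ⟨D, hD, hDn⟩ := hstar
      -- a set that misses an element of `A ∩ B` must contain the rest of `A ∪ B`
      have key : ∀ E ∈ C, ¬ A ∩ B ⊆ E → E ⊆ A ∪ B := by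
        intro E hE hEn
        obtain ⟨w, hw, hwE⟩ := Finset.not_subset.1 hEn
        have hsub : ∀ A ∈ C, w ∈ A → A.erase w ⊆ E := by
          intro A hA hwA
          have h1 : A ∩ E ⊆ A.erase w := fun x hx => by
            rw [Finset.mem_inter] at hx
            exact Finset.mem_erase.2 ⟨fun e => hwE (e ▸ hx.2), hx.1⟩
          have h2 := Finset.eq_of_subset_of_card_le h1 (by
            rw [Finset.card_erase_of_mem hwA, hcard A hA]; exact hint A hA E hE)
          rw [← h2]; exact Finset.inter_subset_right
        rw [Finset.mem_inter] at hw
        have h3 : (A ∪ B).erase w ⊆ E := fun x hx => by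
          rw [Finset.mem_erase, Finset.mem_union] at hx
          exact hx.2.elim (fun h => hsub A hA hw.1 (Finset.mem_erase.2 ⟨hx.1, h⟩))
            (fun h => hsub B hB hw.2 (Finset.mem_erase.2 ⟨hx.1, h⟩))
        have h4 := Finset.eq_of_subset_of_card_le h3 (by
          rw [hcard E hE, Finset.card_erase_of_mem (Finset.mem_union_left _ hw.1), hZ]; omega)
        rw [← h4]; exact Finset.erase_subset _ _
      intro E hE
      by_cases hEs : A ∩ B ⊆ E
      · by_contra hEZ
        obtain ⟨x, hxE, hxZ⟩ := Finset.not_subset.1 hEZ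
        have hxT : x ∉ A ∩ B := fun h => hxZ (Finset.mem_union_left _ (Finset.mem_inter.1 h).1)
        have h1 : insert x (A ∩ B) = E := Finset.eq_of_subset_of_card_le
          (Finset.insert_subset hxE hEs) (by
            rw [Finset.card_insert_of_notMem hxT, hT, hcard E hE])
        have hDZ := key D hD hDn
        have h2 : D ∩ E ⊆ D ∩ (A ∩ B) := fun y hy => by
          rw [← h1, Finset.mem_inter, Finset.mem_insert] at hy
          rcases hy.2 with rfl | h
          · exact absurd (hDZ hy.1) hxZ
          · exact Finset.mem_inter.2 ⟨hy.1, h⟩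
        have h3 : D ∩ (A ∩ B) ⊂ A ∩ B :=
          ⟨Finset.inter_subset_right, fun h => hDn fun y hy => (Finset.mem_inter.1 (h hy)).1⟩
        have h4 := Finset.card_le_card h2
        have h5 := Finset.card_lt_card h3
        have h6 := hint D hD E hE
        omega
      · exact key E hE hEs

/-- A `(t + 1)`-set that shares at least `t` elements with each of two sets with fewer than `t`
common elements consists of their intersection and one more element of either. -/
lemma eq_insert_insert_inter {A A' B : Finset β} (hB : B.card = t + 1)
    (hlt : (A ∩ A').card < t) (h : t ≤ (A ∩ B).card)
    (h' : t ≤ (A' ∩ B).card) : (A ∩ A').card + 1 = t ∧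
      ∃ x ∈ A \ A', ∃ y ∈ A' \ A, B = insert x (insert y (A ∩ A')) := by
  have h1 := Finset.card_union_add_card_inter (A ∩ B) (A' ∩ B)
  have h2 : (A ∩ B ∪ A' ∩ B).card ≤ t + 1 := by
    rw [← hB]
    exact Finset.card_le_card (Finset.union_subset Finset.inter_subset_right
      Finset.inter_subset_right)
  have h3 : (A ∩ B) ∩ (A' ∩ B) ⊆ A ∩ A' :=
    Finset.inter_subset_inter Finset.inter_subset_left Finset.inter_subset_left
  have h4 := Finset.card_le_card h3
  have hW := Finset.eq_of_subset_of_card_le h3 (by omega)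
  have hWB : A ∩ A' ⊆ B := by
    rw [← hW]; exact Finset.inter_subset_left.trans Finset.inter_subset_right
  have ex : ∀ A A' : Finset β, (A ∩ A').card < t → t ≤ (A ∩ B).card → ∃ x ∈ A \ A', x ∈ B := by
    intro A A' hlt h
    have : ∃ x ∈ A ∩ B, x ∉ A ∩ A' := by
      by_contra! hcon
      have := Finset.card_le_card (show A ∩ B ⊆ A ∩ A' from hcon)
      omega
    obtain ⟨x, hx, hx'⟩ := this
    rw [Finset.mem_inter] at hx hx'
    exact ⟨x, Finset.mem_sdiff.2 ⟨hx.1, fun h => hx' ⟨hx.1, h⟩⟩, hx.2⟩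
  obtain ⟨x, hx, hxB⟩ := ex A A' hlt h
  obtain ⟨y, hy, hyB⟩ := ex A' A (by rwa [Finset.inter_comm]) h'
  refine ⟨by omega, x, hx, y, hy, ?_⟩
  rw [Finset.mem_sdiff] at hx hy
  have hyW : y ∉ A ∩ A' := fun h => hy.2 (Finset.mem_inter.1 h).1
  have hxW : x ∉ insert y (A ∩ A') := fun h => by
    rcases Finset.mem_insert.1 h with rfl | h
    · exact hy.2 hx.1
    · exact hx.2 (Finset.mem_inter.1 h).2
  symm
  refine Finset.eq_of_subset_of_card_le
    (Finset.insert_subset hxB (Finset.insert_subset hyB hWB)) ?_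
  rw [Finset.card_insert_of_notMem hxW, Finset.card_insert_of_notMem hyW, hB]
  omega

variable {𝒜 ℬ : Finset (Finset β)}

/-- If `ℬ` consists of at most two sets then the product of the sizes is small. -/
lemma card_mul_card_lt_of_card_le_two (hm : m = max (t + 2) j) (ht : 1 ≤ t)
    (hA : ∀ A ∈ 𝒜, A.card = t + 1) (hB : ∀ B ∈ ℬ, B.card = t + 1)
    (hcr : ∀ A ∈ 𝒜, ∀ B ∈ ℬ, t ≤ (A ∩ B).card)
    (hstar : ∀ T : Finset β, T.card = t → (𝒜.filter (T ⊆ ·)).card ≤ j)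
    (hint : ∀ B ∈ ℬ, ∀ B' ∈ ℬ, t ≤ (B ∩ B').card) (h2 : ℬ.card ≤ 2) :
    𝒜.card * ℬ.card < m ^ 2 := by
  have hmt : t + 2 ≤ m := hm ▸ le_max_left _ _
  have hmj : j ≤ m := hm ▸ le_max_right _ _
  obtain h | h | h : ℬ.card = 0 ∨ ℬ.card = 1 ∨ ℬ.card = 2 := by omega
  · rw [h, mul_zero]; exact pow_pos (by omega) 2
  · obtain ⟨B, rfl⟩ := Finset.card_eq_one.1 h
    have hsub : 𝒜 ⊆ (B.powersetCard t).biUnion fun T => 𝒜.filter (T ⊆ ·) := by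
      intro A hAm
      obtain ⟨T, hT, hTc⟩ := Finset.exists_subset_card_eq (hcr A hAm B (by simp))
      exact Finset.mem_biUnion.2 ⟨T, Finset.mem_powersetCard.2
        ⟨hT.trans Finset.inter_subset_right, hTc⟩,
        Finset.mem_filter.2 ⟨hAm, hT.trans Finset.inter_subset_left⟩⟩
    have := (Finset.card_le_card hsub).trans (Finset.card_biUnion_le_card_mul _ _ j
      fun T hT => hstar T (Finset.mem_powersetCard.1 hT).2)
    rw [Finset.card_powersetCard, hB B (by simp), Nat.choose_succ_self_right] at this
    rw [Finset.card_singleton, mul_one, sq]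
    calc 𝒜.card ≤ (t + 1) * j := this
      _ ≤ (t + 1) * m := Nat.mul_le_mul_left _ hmj
      _ < m * m := Nat.mul_lt_mul_of_pos_right (by omega) (by omega)
  · obtain ⟨B, B', hne, rfl⟩ := Finset.card_eq_two.1 h
    have hBc := hB B (by simp)
    have hBc' := hB B' (by simp)
    have hTge := hint B (by simp) B' (by simp)
    have hlt : (B ∩ B').card < t + 1 := by
      rw [← hBc]
      refine Finset.card_lt_card ⟨Finset.inter_subset_left, fun h => hne ?_⟩
      exact Finset.eq_of_subset_of_card_le (fun x hx => (Finset.mem_inter.1 (h hx)).2)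
        (by rw [hBc, hBc'])
    have hT : (B ∩ B').card = t := by omega
    have hZ : (B ∪ B').card = t + 2 := by
      have := Finset.card_union_add_card_inter B B'
      omega
    have hsub : 𝒜 ⊆ 𝒜.filter (B ∩ B' ⊆ ·) ∪ (B ∩ B').image fun w => (B ∪ B').erase w := by
      intro A hAm
      by_cases hTA : B ∩ B' ⊆ A
      · exact Finset.mem_union_left _ (Finset.mem_filter.2 ⟨hAm, hTA⟩)
      · obtain ⟨w, hw, hwA⟩ := Finset.not_subset.1 hTA
        refine Finset.mem_union_right _ (Finset.mem_image.2 ⟨w, hw, ?_⟩)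
        have hsub : ∀ D ∈ ({B, B'} : Finset (Finset β)), w ∈ D → D.erase w ⊆ A := by
          intro D hD hwD
          have h1 : A ∩ D ⊆ D.erase w := fun x hx => by
            rw [Finset.mem_inter] at hx
            exact Finset.mem_erase.2 ⟨fun e => hwA (e ▸ hx.1), hx.2⟩
          have h2 := Finset.eq_of_subset_of_card_le h1 (by
            rw [Finset.card_erase_of_mem hwD, hB D hD]; exact hcr A hAm D hD)
          rw [← h2]; exact Finset.inter_subset_left
        rw [Finset.mem_inter] at hw
        refine Finset.eq_of_subset_of_card_le (fun x hx => ?_) ?_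
        · rw [Finset.mem_erase, Finset.mem_union] at hx
          exact hx.2.elim (fun h => hsub B (by simp) hw.1 (Finset.mem_erase.2 ⟨hx.1, h⟩))
            (fun h => hsub B' (by simp) hw.2 (Finset.mem_erase.2 ⟨hx.1, h⟩))
        · rw [hA A hAm, Finset.card_erase_of_mem (Finset.mem_union_left _ hw.1), hZ]; omega
    have h1 := (Finset.card_le_card hsub).trans (Finset.card_union_le _ _)
    have h3 := hstar _ hT
    have h4 : ((B ∩ B').image fun w => (B ∪ B').erase w).card ≤ t := hT ▸ Finset.card_image_le
    rw [h]
    obtain ⟨n, rfl⟩ : ∃ n, m = n + 3 := ⟨m - 3, by omega⟩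
    calc 𝒜.card * 2 ≤ 4 * n + 8 := by omega
      _ < (n + 3) ^ 2 := by nlinarith

/-- The exceptional pair of families of three 2-sets each. -/
def IsSquarePair (𝒜 ℬ : Finset (Finset β)) : Prop :=
  ∃ e₁ e₂ e₃ e₄ : β, 𝒜 = {{e₁, e₂}, {e₃, e₄}, {e₁, e₄}} ∧ ℬ = {{e₁, e₃}, {e₂, e₄}, {e₁, e₄}}

lemma IsSquarePair.symm (h : IsSquarePair 𝒜 ℬ) : IsSquarePair ℬ 𝒜 := by
  obtain ⟨e₁, e₂, e₃, e₄, h1, h2⟩ := h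
  exact ⟨e₁, e₃, e₂, e₄, h2, h1⟩

/-- If `𝒜` contains two sets with fewer than `t` common elements, then all sets of `ℬ` lie on a
cycle of four sets. -/
lemma card_mul_card_lt_or_isSquarePair (hm : m = max (t + 2) j) (ht : 1 ≤ t)
    (hA : ∀ A ∈ 𝒜, A.card = t + 1) (hB : ∀ B ∈ ℬ, B.card = t + 1)
    (hcr : ∀ A ∈ 𝒜, ∀ B ∈ ℬ, t ≤ (A ∩ B).card)
    (hstar : ∀ T : Finset β, T.card = t → (𝒜.filter (T ⊆ ·)).card ≤ j)
    {A A' : Finset β} (hAm : A ∈ 𝒜) (hAm' : A' ∈ 𝒜) (hlt : (A ∩ A').card < t) :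
    𝒜.card * ℬ.card < m ^ 2 ∨ t = 1 ∧ j ≤ 3 ∧ IsSquarePair 𝒜 ℬ := by
  have hmt : t + 2 ≤ m := hm ▸ le_max_left _ _
  have hm9 : 9 ≤ m ^ 2 := by nlinarith
  rcases ℬ.eq_empty_or_nonempty with rfl | ⟨D₀, hD₀⟩
  · left; simp; omega
  obtain ⟨B₀, hB₀, hopp⟩ : ∃ B₀ ∈ ℬ, (∃ B' ∈ ℬ, (B₀ ∩ B').card < t) ∨
      ∀ B ∈ ℬ, ∀ B' ∈ ℬ, t ≤ (B ∩ B').card := by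
    by_cases h : ∀ B ∈ ℬ, ∀ B' ∈ ℬ, t ≤ (B ∩ B').card
    · exact ⟨D₀, hD₀, Or.inr h⟩
    · push Not at h
      obtain ⟨B, hBm, h⟩ := h
      exact ⟨B, hBm, Or.inl h⟩
  set W := A ∩ A' with hW
  have hWc : W.card + 1 = t := (eq_insert_insert_inter (hB B₀ hB₀) hlt
    (hcr A hAm B₀ hB₀) (hcr A' hAm' B₀ hB₀)).1
  have hsd : ∀ D D' : Finset β, D.card = t + 1 → (D ∩ D').card + 1 = t → ∀ x ∈ D \ D',
      ∃ x' ∈ D \ D', x' ≠ x ∧ ∀ y ∈ D \ D', y = x ∨ y = x' := by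
    intro D D' hD hDD x hx
    have hc2 : (D \ D').card = 2 := by
      have := Finset.card_sdiff_add_card_inter D D'
      omega
    obtain ⟨a, b, hab, h⟩ := Finset.card_eq_two.1 hc2
    rw [h] at hx ⊢
    rcases Finset.mem_insert.1 hx with rfl | hx
    · exact ⟨b, by simp, hab.symm, by simp⟩
    · obtain rfl := Finset.mem_singleton.1 hx
      exact ⟨a, by simp, hab, by simp [or_comm]⟩
  -- each member of `ℬ` is given by an element of `A \ A'` and one of `A' \ A`
  have hform : ∀ B ∈ ℬ, ∃ x ∈ A \ A', ∃ y ∈ A' \ A, B = insert x (insert y W) := fun B hBm =>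
    (eq_insert_insert_inter (hB B hBm) hlt (hcr A hAm B hBm)
      (hcr A' hAm' B hBm)).2
  have hsmall : ∀ a b c d : β, a ≠ c → a ≠ d → b ≠ c → b ≠ d →
      (insert a (insert b W) ∩ insert c (insert d W)).card < t := by
    intro a b c d h1 h2 h3 h4
    have : insert a (insert b W) ∩ insert c (insert d W) ⊆ W := by
      intro x hx
      simp only [Finset.mem_inter, Finset.mem_insert] at hx
      obtain ⟨rfl | rfl | h, h'⟩ := hx
      · tauto
      · tauto
      · exact h
    have := Finset.card_le_card this
    omega
  have hlarge : ∀ (D D' : Finset β) (a : β), a ∉ W → a ∈ D → a ∈ D' → W ⊆ D → W ⊆ D' →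
      t ≤ (D ∩ D').card := by
    intro D D' a ha h1 h2 h3 h4
    rw [← hWc, ← Finset.card_insert_of_notMem ha]
    exact Finset.card_le_card (Finset.insert_subset (Finset.mem_inter.2 ⟨h1, h2⟩)
      (Finset.subset_inter h3 h4))
  obtain ⟨p, hp, r, hr, hB₀'⟩ := hform B₀ hB₀
  obtain ⟨q, hq, hqp, hpq⟩ := hsd A A' (hA A hAm) hWc p hp
  obtain ⟨s, hs, hsr, hrs⟩ := hsd A' A (hA A' hAm') (by rwa [Finset.inter_comm]) r hr
  have hneq : ∀ x ∈ A \ A', ∀ y ∈ A' \ A, x ≠ y := fun x hx y hy h =>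
    (Finset.mem_sdiff.1 hx).2 (h ▸ (Finset.mem_sdiff.1 hy).1)
  have hpr := hneq p hp r hr
  have hps := hneq p hp s hs
  have hqr := hneq q hq r hr
  have hqs := hneq q hq s hs
  have hpW : p ∉ W := fun h => (Finset.mem_sdiff.1 hp).2 (Finset.mem_inter.1 h).2
  have hrW : r ∉ W := fun h => (Finset.mem_sdiff.1 hr).2 (Finset.mem_inter.1 h).1
  have hBsub : ∀ B ∈ ℬ, B = insert p (insert r W) ∨ B = insert p (insert s W) ∨
      B = insert q (insert r W) ∨ B = insert q (insert s W) := by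
    intro B hBm
    obtain ⟨x, hx, y, hy, rfl⟩ := hform B hBm
    rcases hpq x hx with rfl | rfl <;> rcases hrs y hy with rfl | rfl <;> simp
  rcases hopp with ⟨B', hBm', hltB⟩ | hopp
  · have hB' : B' = insert q (insert s W) := by
      rcases hBsub B' hBm' with h | h | h | h
      · exact absurd (hlarge B₀ B' p hpW (by simp [hB₀']) (by simp [h])
          (by simp [hB₀', Finset.subset_iff]; tauto) (by simp [h, Finset.subset_iff]; tauto))
          (by omega)
      · exact absurd (hlarge B₀ B' p hpW (by simp [hB₀']) (by simp [h])
          (by simp [hB₀', Finset.subset_iff]; tauto) (by simp [h, Finset.subset_iff]; tauto))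
          (by omega)
      · exact absurd (hlarge B₀ B' r hrW (by simp [hB₀']) (by simp [h])
          (by simp [hB₀', Finset.subset_iff]; tauto) (by simp [h, Finset.subset_iff]; tauto))
          (by omega)
      · exact h
    have hinter : B₀ ∩ B' = W := by
      have hsub : W ⊆ B₀ ∩ B' := by
        rw [hB₀', hB']
        exact Finset.subset_inter (fun x hx => by simp [hx]) (fun x hx => by simp [hx])
      exact (Finset.eq_of_subset_of_card_le hsub (by omega)).symm
    have hAsub : ∀ D ∈ 𝒜, D = insert p (insert q W) ∨ D = insert p (insert s W) ∨
        D = insert r (insert q W) ∨ D = insert r (insert s W) := by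
      intro D hD
      obtain ⟨-, x, hx, y, hy, rfl⟩ := eq_insert_insert_inter (hA D hD)
        hltB (by rw [Finset.inter_comm]; exact hcr D hD B₀ hB₀)
        (by rw [Finset.inter_comm]; exact hcr D hD B' hBm')
      rw [hinter]
      have hx' : x = p ∨ x = r := by
        rw [hB₀', hB'] at hx
        simp only [Finset.mem_sdiff, Finset.mem_insert] at hx
        tauto
      have hy' : y = q ∨ y = s := by
        rw [hB₀', hB'] at hy
        simp only [Finset.mem_sdiff, Finset.mem_insert] at hy
        tauto
      rcases hx' with rfl | rfl <;> rcases hy' with rfl | rfl <;> simp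
    have h1 : insert p (insert s W) ∈ 𝒜 → insert q (insert r W) ∉ ℬ := fun h h' =>
      absurd (hcr _ h _ h') (not_le.2 (hsmall p s q r hqp.symm hpr hqs.symm hsr))
    have h2 : insert r (insert q W) ∈ 𝒜 → insert p (insert s W) ∉ ℬ := fun h h' =>
      absurd (hcr _ h _ h') (not_le.2 (hsmall r q p s hpr.symm hsr.symm hqp hqs))
    have h4 : ∀ {C : Finset (Finset β)} {a b c d : Finset β},
        (∀ x ∈ C, x = a ∨ x = b ∨ x = c ∨ x = d) → C.card ≤ 4 := fun {C a b c d} h =>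
      (Finset.card_le_card (t := {a, b, c, d}) fun x hx => by simpa using h x hx).trans
        Finset.card_le_four
    have h3 : ∀ {C : Finset (Finset β)} {a b c : Finset β},
        (∀ x ∈ C, x = a ∨ x = b ∨ x = c) → C.card < 3 ∨ C = {a, b, c} := by
      intro C a b c h
      have hsub : C ⊆ {a, b, c} := fun x hx => by simpa using h x hx
      by_cases hC : C.card < 3
      · exact Or.inl hC
      · exact Or.inr (Finset.eq_of_subset_of_card_le hsub (Finset.card_le_three.trans (by omega)))
    have h2' : ∀ {C : Finset (Finset β)} {a b : Finset β},
        (∀ x ∈ C, x = a ∨ x = b) → C.card ≤ 2 := fun {C a b} h =>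
      (Finset.card_le_card (t := {a, b}) fun x hx => by simpa using h x hx).trans
        Finset.card_le_two
    -- three sets on either side
    have hthree : ∀ a b c d : β, (∀ D ∈ 𝒜, D = insert a (insert b W) ∨ D = insert c (insert d W) ∨
        D = insert a (insert d W)) → (∀ D ∈ ℬ, D = insert a (insert c W) ∨
        D = insert b (insert d W) ∨ D = insert a (insert d W)) →
        𝒜.card * ℬ.card < m ^ 2 ∨ t = 1 ∧ j ≤ 3 ∧ IsSquarePair 𝒜 ℬ := by
      intro a b c d hAs hBs
      have hA3 : 𝒜.card ≤ 3 := (h3 hAs).elim (fun h => h.le) fun h => h ▸ Finset.card_le_three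
      have hB3 : ℬ.card ≤ 3 := (h3 hBs).elim (fun h => h.le) fun h => h ▸ Finset.card_le_three
      by_cases hm3 : m ≤ 3
      · rcases h3 hAs with h | hA'
        · left; nlinarith
        · rcases h3 hBs with h | hB'
          · left; nlinarith
          · have hW0 : W = ∅ := Finset.card_eq_zero.1 (by omega)
            refine Or.inr ⟨by omega, (hm ▸ le_max_right _ _ : j ≤ m).trans hm3, a, b, c, d, ?_, ?_⟩
            · rw [hA', hW0]; simp
            · rw [hB', hW0]; simp
      · left
        push Not at hm3
        nlinarith
    by_cases hPS : insert p (insert s W) ∈ 𝒜 <;> by_cases hRQ : insert r (insert q W) ∈ 𝒜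
    · have hB2 : ℬ.card ≤ 2 := h2' (a := insert p (insert r W)) (b := insert q (insert s W))
        fun x hx => by
          rcases hBsub x hx with h | h | h | h
          · exact Or.inl h
          · exact absurd (h ▸ hx) (h2 hRQ)
          · exact absurd (h ▸ hx) (h1 hPS)
          · exact Or.inr h
      left
      nlinarith [h4 hAsub]
    · refine hthree p q r s (fun D hD => ?_) fun D hD => ?_
      · rcases hAsub D hD with h | h | h | h
        · exact Or.inl h
        · exact Or.inr (Or.inr h)
        · exact absurd (h ▸ hD) hRQ
        · exact Or.inr (Or.inl h)
      · rcases hBsub D hD with h | h | h | h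
        · exact Or.inl h
        · exact Or.inr (Or.inr h)
        · exact absurd (h ▸ hD) (h1 hPS)
        · exact Or.inr (Or.inl h)
    · refine hthree r s p q (fun D hD => ?_) fun D hD => ?_
      · rcases hAsub D hD with h | h | h | h
        · exact Or.inr (Or.inl h)
        · exact absurd (h ▸ hD) hPS
        · exact Or.inr (Or.inr h)
        · exact Or.inl h
      · rcases hBsub D hD with h | h | h | h
        · exact Or.inl (h.trans (Finset.insert_comm _ _ _))
        · exact absurd (h ▸ hD) (h2 hRQ)
        · exact Or.inr (Or.inr (h.trans (Finset.insert_comm _ _ _)))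
        · exact Or.inr (Or.inl (h.trans (Finset.insert_comm _ _ _)))
    · have hA2 : 𝒜.card ≤ 2 := h2' (a := insert p (insert q W)) (b := insert r (insert s W))
        fun x hx => by
          rcases hAsub x hx with h | h | h | h
          · exact Or.inl h
          · exact absurd (h ▸ hx) hPS
          · exact absurd (h ▸ hx) hRQ
          · exact Or.inr h
      left
      nlinarith [h4 hBsub]
  · left
    refine card_mul_card_lt_of_card_le_two hm ht hA hB hcr hstar hopp ?_
    have hone : ∀ a b c d : β, a ≠ c → a ≠ d → b ≠ c → b ≠ d →
        (ℬ.filter fun B => B = insert a (insert b W) ∨ B = insert c (insert d W)).card ≤ 1 := by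
      intro a b c d h1 h2 h3 h4
      refine Finset.card_le_one.2 fun B hBm B' hBm' => ?_
      rw [Finset.mem_filter] at hBm hBm'
      have h5 := hsmall a b c d h1 h2 h3 h4
      have h6 := hopp B hBm.1 B' hBm'.1
      rcases hBm.2 with e | e <;> rcases hBm'.2 with e' | e'
      · rw [e, e']
      · rw [e, e'] at h6; omega
      · rw [e, e', Finset.inter_comm] at h6; omega
      · rw [e, e']
    have hsub : ℬ ⊆
        (ℬ.filter fun B => B = insert p (insert r W) ∨ B = insert q (insert s W)) ∪
        (ℬ.filter fun B => B = insert p (insert s W) ∨ B = insert q (insert r W)) := by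
      intro B hBm
      rw [Finset.mem_union, Finset.mem_filter, Finset.mem_filter]
      have := hBsub B hBm
      tauto
    have h1 := (Finset.card_le_card hsub).trans (Finset.card_union_le _ _)
    have h2 := hone p r q s hqp.symm hps hqr.symm hsr.symm
    have h3 := hone p s q r hqp.symm hpr hqs.symm hsr
    omega

/-- The structure of two cross `t`-intersecting families of `(t + 1)`-sets, with at most `j` sets
of either family through any `t` elements, the product of whose sizes is not small. -/
lemma crossIntersecting_structure (hm : m = max (t + 2) j) (ht : 1 ≤ t)
    (hA : ∀ A ∈ 𝒜, A.card = t + 1) (hB : ∀ B ∈ ℬ, B.card = t + 1) (hne : 𝒜.Nonempty)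
    (hcr : ∀ A ∈ 𝒜, ∀ B ∈ ℬ, t ≤ (A ∩ B).card)
    (hstarA : ∀ T : Finset β, T.card = t → (𝒜.filter (T ⊆ ·)).card ≤ j)
    (hstarB : ∀ T : Finset β, T.card = t → (ℬ.filter (T ⊆ ·)).card ≤ j) :
    𝒜.card * ℬ.card < m ^ 2 ∨ (t = 1 ∧ j ≤ 3 ∧ IsSquarePair 𝒜 ℬ) ∨
      (∃ T : Finset β, T.card = t ∧ (∀ A ∈ 𝒜, T ⊆ A) ∧ ∀ B ∈ ℬ, T ⊆ B) ∨
      ∃ Z : Finset β, Z.card = t + 2 ∧ (∀ A ∈ 𝒜, A ⊆ Z) ∧ ∀ B ∈ ℬ, B ⊆ Z := by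
  have hcr' : ∀ B ∈ ℬ, ∀ A ∈ 𝒜, t ≤ (B ∩ A).card := fun B hBm A hAm => by
    rw [Finset.inter_comm]; exact hcr A hAm B hBm
  by_cases h1 : ∃ A ∈ 𝒜, ∃ A' ∈ 𝒜, (A ∩ A').card < t
  · obtain ⟨A, hAm, A', hAm', hlt⟩ := h1
    exact (card_mul_card_lt_or_isSquarePair hm ht hA hB hcr hstarA hAm hAm' hlt).imp_right Or.inl
  by_cases h2 : ∃ B ∈ ℬ, ∃ B' ∈ ℬ, (B ∩ B').card < t
  · obtain ⟨B, hBm, B', hBm', hlt⟩ := h2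
    rw [mul_comm]
    exact (card_mul_card_lt_or_isSquarePair hm ht hB hA hcr' hstarB hBm hBm' hlt).imp_right
      fun h => Or.inl ⟨h.1, h.2.1, h.2.2.symm⟩
  push Not at h1 h2
  have := exists_kernel_or_hull (t := t) (C := 𝒜 ∪ ℬ) (hne.mono Finset.subset_union_left)
    (fun D hD => (Finset.mem_union.1 hD).elim (hA D) (hB D)) (by
      intro D hD D' hD'
      rcases Finset.mem_union.1 hD with h | h <;> rcases Finset.mem_union.1 hD' with h' | h'
      · exact h1 D h D' h'
      · exact hcr D h D' h'
      · exact hcr' D h D' h'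
      · exact h2 D h D' h')
  rcases this with ⟨T, hT, h⟩ | ⟨Z, hZ, h⟩
  · exact Or.inr (Or.inr (Or.inl ⟨T, hT, fun A hAm => h A (Finset.mem_union_left _ hAm),
      fun B hBm => h B (Finset.mem_union_right _ hBm)⟩))
  · exact Or.inr (Or.inr (Or.inr ⟨Z, hZ, fun A hAm => h A (Finset.mem_union_left _ hAm),
      fun B hBm => h B (Finset.mem_union_right _ hBm)⟩))

end SetFamilies

/-! ### Covers of the families in a maximum pair -/

section Maximal

variable {c k t j m : ℕ} {FF GG : Finset (BlockFamily c k)}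

lemma IsNontrivialCrossPair.symm (h : IsNontrivialCrossPair c k t FF GG) :
    IsNontrivialCrossPair c k t GG FF :=
  ⟨h.2.1, h.1, h.2.2.1.symm, h.2.2.2.2, h.2.2.2.1⟩

lemma IsMaxNontrivialCrossPair.symm (h : IsMaxNontrivialCrossPair c k t FF GG) :
    IsMaxNontrivialCrossPair c k t GG FF :=
  ⟨h.1.symm, fun FF' GG' h' => by
    rw [mul_comm, mul_comm GG.card]; exact h.2 GG' FF' h'.symm⟩

lemma card_commonBlocks_le {FF' : Finset (BlockFamily c k)} (h : FF ⊆ FF') :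
    (commonBlocks FF').card ≤ (commonBlocks FF).card := by
  refine Finset.card_le_card fun b hb => ?_
  rw [commonBlocks, Finset.mem_filter] at hb ⊢
  exact ⟨hb.1, fun F hF => hb.2 F (h hF)⟩

/-- A maximum pair cannot be enlarged. -/
lemma IsMaxNontrivialCrossPair.mem (h : IsMaxNontrivialCrossPair c k t FF GG)
    (hG : GG.Nonempty) {F : BlockFamily c k} (hF : F ∈ U c k k)
    (hcr : ∀ G ∈ GG, t ≤ (F ∩ G).card) : F ∈ FF := by
  by_contra hn
  obtain ⟨⟨h1, h2, h3, h4, h5⟩, hmax⟩ := h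
  have := hmax (insert F FF) GG ⟨Finset.insert_subset hF h1, h2, fun F' hF' G hG => by
    rcases Finset.mem_insert.1 hF' with rfl | h
    · exact hcr G hG
    · exact h3 F' h G hG, (card_commonBlocks_le (Finset.subset_insert _ _)).trans_lt h4, h5⟩
  rw [Finset.card_insert_of_notMem hn, Nat.succ_mul] at this
  have := Finset.card_pos.2 hG
  omega

/-- The covers of `FF` that consist of `s` pairwise disjoint blocks. -/
def covers (t s : ℕ) (FF : Finset (BlockFamily c k)) : Finset (BlockFamily c k) :=
  (U c k s).filter fun S => ∀ F ∈ FF, t ≤ (F ∩ S).card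

lemma mem_covers {s : ℕ} {S : BlockFamily c k} :
    S ∈ covers t s FF ↔ S ∈ U c k s ∧ IsCover t FF S := by
  simp [covers, IsCover]

/-- The examples `N₁` and `N₂` bound the product of the sizes of a maximum pair from below. -/
lemma exists_benchmark (hc : 0 < c) (ht : 1 ≤ t) (hj : t + 1 + j = k) (hj2 : 2 ≤ j)
    (hm : m = max (t + 2) j) (hp : partitionCount c (j - 1) < partitionCount c j)
    (hp2 : partitionCount c 1 < partitionCount c 2)
    (hmax : IsMaxNontrivialCrossPair c k t FF GG) :
    ∃ N, m * (partitionCount c j - m * partitionCount c (j - 1)) ≤ N ∧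
      N * N ≤ FF.card * GG.card := by
  rcases le_total (t + 2) j with h | h
  · obtain ⟨L, hL⟩ := exists_mem_U (c := c) (k := k) (s := k - 1) hc (by omega)
    obtain ⟨T, hTL, hTc⟩ := Finset.exists_subset_card_eq (s := L) (n := t)
      (by rw [card_of_mem_U hL]; omega)
    have hT := hTc ▸ mem_U_of_subset hL hTL
    refine ⟨(N₁ c k t T L L).card, ?_,
      hmax.2 _ _ (isNontrivialCrossPair_N₁ hc ht hj hj2 hp hp2 hT hL hTL)⟩
    rw [hm, max_eq_right h]
    exact card_N₁_ge hc hj hT hL hTL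
  · obtain ⟨Z, hZ⟩ := exists_mem_U (c := c) (k := k) (s := t + 2) hc (by omega)
    refine ⟨(N₂ c k t Z).card, ?_, hmax.2 _ _ (isNontrivialCrossPair_N₂ hc ht hj hp hZ)⟩
    rw [hm, max_eq_left h]
    refine le_trans ?_ ((Nat.le_add_right _ _).trans (card_N₂_ge hc hj hZ))
    refine Nat.mul_le_mul_left _ (Nat.sub_le_sub_left ?_ _)
    exact Nat.le_mul_of_pos_left _ (by omega)

lemma exists_min_cover (hne : FF.Nonempty) (hcommon : (commonBlocks FF).card < t)
    {G : BlockFamily c k} (hG : G ∈ U c k k) (hcov : IsCover t FF G) :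
    ∃ d, ∃ S ∈ U c k (t + 1 + d), IsCover t FF S ∧
      ∀ s < t + 1 + d, ∀ S ∈ U c k s, ¬ IsCover t FF S := by
  classical
  have hex : ∃ s, ∃ S ∈ U c k s, IsCover t FF S := ⟨k, G, hG, hcov⟩
  obtain ⟨S, hS, hS'⟩ := Nat.find_spec hex
  have hlt : t + 1 ≤ Nat.find hex := by
    by_contra hcon
    exact not_isCover_of_card_le hne hcommon hS (by omega) hS'
  obtain ⟨d, hd⟩ := Nat.exists_eq_add_of_le hlt
  rw [hd] at hS
  refine ⟨d, S, hS, hS', fun s hs S' hS' hcov' => Nat.find_min hex (hd ▸ hs) ⟨S', hS', hcov'⟩⟩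

/-- In a maximum pair both families have covers of `t + 1` blocks. -/
lemma covers_nonempty (hc : 0 < c) (hj : t + 1 + j = k)
    (hm : m = max (t + 2) j) (hP : 7 * m ^ 5 * partitionCount c (j - 1) ≤ partitionCount c j)
    (hW : ∀ d, 1 ≤ d → d ≤ j → 2 * coverWeight c t j d ≤ partitionCount c j)
    (hpair : IsNontrivialCrossPair c k t FF GG) (hF : FF.Nonempty) (hG : GG.Nonempty) {N : ℕ}
    (hN : m * (partitionCount c j - m * partitionCount c (j - 1)) ≤ N)
    (hNFG : N * N ≤ FF.card * GG.card) :
    (covers t (t + 1) FF).Nonempty ∧ (covers t (t + 1) GG).Nonempty := by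
  obtain ⟨hFU, hGU, hcr, hcF, hcG⟩ := hpair
  obtain ⟨F₀, hF₀⟩ := hF
  obtain ⟨G₀, hG₀⟩ := hG
  obtain ⟨d, S, hS, hSc, hmin⟩ := exists_min_cover ⟨F₀, hF₀⟩ hcF (hGU hG₀)
    (fun F hF => hcr F hF G₀ hG₀)
  obtain ⟨d', S', hS', hSc', hmin'⟩ := exists_min_cover ⟨G₀, hG₀⟩ hcG (hFU hF₀)
    (fun G hG => hcr.symm G hG F₀ hF₀)
  have hdj : d ≤ j := by have := le_of_mem_U hc hS; omega
  have hdj' : d' ≤ j := by have := le_of_mem_U hc hS'; omega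
  have h1 := card_le_choose_mul_descFactorial hc hFU hGU hcr (b := t + 1 + d') (by omega)
    (fun s hs S hS _ _ _ => hmin' s hs S hS) hS hSc
  have h2 := card_le_choose_mul_descFactorial hc hGU hFU hcr.symm (b := t + 1 + d) (by omega)
    (fun s hs S hS _ _ _ => hmin s hs S hS) hS' hSc'
  have hprod : FF.card * GG.card ≤ coverWeight c t j d * coverWeight c t j d' := by
    refine (Nat.mul_le_mul h1 h2).trans (le_of_eq ?_)
    rw [coverWeight, coverWeight, show k - t = j + 1 by omega,
      show k - (t + 1 + d') = j - d' by omega, show k - (t + 1 + d) = j - d by omega,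
      show t + 1 + d' - t = d' + 1 by omega, show t + 1 + d - t = d + 1 by omega]
    ring
  have hhalf : ∀ d ≤ j, coverWeight c t j d ≤ (t + 1) * (j + 1) * partitionCount c j ∨
      2 * coverWeight c t j d ≤ partitionCount c j := by
    intro d hd
    rcases Nat.eq_zero_or_pos d with rfl | h
    · exact Or.inl coverWeight_zero.le
    · exact Or.inr (hW d h hd)
  have hq := partitionCount_pos (c := c) (j - 1)
  have hd0 : d = 0 := by
    by_contra h
    have := mul_lt_sq_of_half hm hP hq hN (hhalf d' hdj') (hW d (by omega) hdj)
    rw [mul_comm] at this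
    omega
  have hd0' : d' = 0 := by
    by_contra h
    have := mul_lt_sq_of_half hm hP hq hN (hhalf d hdj) (hW d' (by omega) hdj')
    omega
  subst hd0 hd0'
  exact ⟨⟨S, mem_covers.2 ⟨hS, hSc⟩⟩, ⟨S', mem_covers.2 ⟨hS', hSc'⟩⟩⟩

/-- Up to lower order terms, the members of `FF` are the partitions that contain a cover of `GG`
with `t + 1` blocks. -/
lemma card_le_card_covers_mul (hc : 0 < c) (hj : t + 1 + j = k)
    (hpair : IsNontrivialCrossPair c k t FF GG) (hG : GG.Nonempty)
    (hB : (covers t (t + 1) FF).Nonempty) :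
    FF.card ≤ (covers t (t + 1) GG).card * partitionCount c j +
      (t + 1) * ((j + 1) * (j * partitionCount c (j - 1))) := by
  obtain ⟨hFU, hGU, hcr, hcF, hcG⟩ := hpair
  obtain ⟨B, hB⟩ := hB
  obtain ⟨hBU, hBc⟩ := mem_covers.1 hB
  set R := FF.filter fun F => ∀ A ∈ covers t (t + 1) GG, ¬ A ⊆ F with hR
  have hRF : R ⊆ FF := Finset.filter_subset _ _
  have hsub : FF ⊆ (covers t (t + 1) GG).biUnion above ∪ R := by
    intro F hF
    by_cases h : ∀ A ∈ covers t (t + 1) GG, ¬ A ⊆ F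
    · exact Finset.mem_union_right _ (Finset.mem_filter.2 ⟨hF, h⟩)
    · push Not at h
      obtain ⟨A, hA, hAF⟩ := h
      exact Finset.mem_union_left _ (Finset.mem_biUnion.2 ⟨A, hA, mem_above.2 ⟨hFU hF, hAF⟩⟩)
  have h1 := (Finset.card_le_card hsub).trans (Finset.card_union_le _ _)
  have h2 := Finset.card_biUnion_le_card_mul (covers t (t + 1) GG) above (partitionCount c j)
    (fun A hA => by
      rw [card_above hc (mem_covers.1 hA).1, show k - (t + 1) = j by omega])
  have h3 := card_le_choose_mul_descFactorial hc (hRF.trans hFU) hGU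
    (fun F hF G hG => hcr F (hRF hF) G hG) (b := t + 2) (by omega) (by
      intro s hs S hS F hF hSF hcov
      rcases Nat.lt_or_ge t s with h | h
      · obtain rfl : s = t + 1 := by omega
        exact (Finset.mem_filter.1 hF).2 S (mem_covers.2 ⟨hS, hcov⟩) hSF
      · exact not_isCover_of_card_le hG hcG hS h hcov) hBU (fun F hF => hBc F (hRF hF))
  rw [Nat.choose_succ_self_right, show k - t = j + 1 by omega, Nat.add_sub_cancel_left,
    show k - (t + 2) = j - 1 by omega, Nat.succ_descFactorial_succ, Nat.descFactorial_one,
    mul_assoc] at h3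
  omega

/-- Covers of the two families of a maximum pair meet in at least `t` blocks. -/
lemma card_inter_covers (hc : 0 < c) (hj : t + 1 + j = k)
    (hp : (t + 1) * partitionCount c (j - 1) < partitionCount c j)
    (hmax : IsMaxNontrivialCrossPair c k t FF GG) (hG : GG.Nonempty)
    {A B : BlockFamily c k} (hA : A ∈ covers t (t + 1) GG) (hB : B ∈ covers t (t + 1) FF) :
    t ≤ (A ∩ B).card := by
  obtain ⟨hAU, hAc⟩ := mem_covers.1 hA
  obtain ⟨hBU, hBc⟩ := mem_covers.1 hB
  obtain ⟨F, hF, hAF, hd⟩ := exists_above_disjoint hc hAU (X := B \ A) Finset.disjoint_sdiff (by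
    rw [show k - (t + 1) = j by omega]
    refine lt_of_le_of_lt (Nat.mul_le_mul_right _ ?_) hp
    exact (Finset.card_le_card Finset.sdiff_subset).trans (card_of_mem_U hBU).le)
  have hFF : F ∈ FF := hmax.mem hG hF fun G hG => by
    rw [Finset.inter_comm]
    exact (hAc G hG).trans (Finset.card_le_card (Finset.inter_subset_inter_left hAF))
  refine (hBc F hFF).trans (Finset.card_le_card fun x hx => ?_)
  rw [Finset.mem_inter] at hx ⊢
  refine ⟨?_, hx.2⟩
  by_contra hxA
  exact Finset.disjoint_left.1 hd hx.1 (Finset.mem_sdiff.2 ⟨hx.2, hxA⟩)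

/-- The covers of `GG` through a given set `T` of `t` blocks arise by adding to `T` one of the
blocks in a set `E`. If `G` does not contain `T`, then it contains `E` and all blocks of `T` but one;
as the last block of a partition is determined by the others, `T ∪ E` is not a partition. -/
lemma star_structure (hc : 0 < c) (htk : t < k) {T G : BlockFamily c k} (hT : T ∈ U c k t)
    (hG : G ∈ U c k k) (hTG : ¬ T ⊆ G) {D : Finset (BlockFamily c k)}
    (hD : ∀ A ∈ D, A ∈ U c k (t + 1) ∧ T ⊆ A ∧ t ≤ (G ∩ A).card) :
    D.biUnion id \ T ⊆ G ∧ (∀ A, A ∈ D ↔ ∃ e ∈ D.biUnion id \ T, A = insert e T) ∧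
      (D.biUnion id \ T).card = D.card ∧
      T ∪ (D.biUnion id \ T) ∈ U c k (t + D.card) ∧ t + D.card + 1 ≤ k := by
  obtain ⟨h, hhT, hhG⟩ := Finset.not_subset.1 hTG
  set E := D.biUnion id \ T with hE
  have hins : ∀ A ∈ D, ∃ e, e ∉ T ∧ A = insert e T := by
    intro A hA
    obtain ⟨h1, h2, -⟩ := hD A hA
    have : (A \ T).card = 1 := by
      rw [Finset.card_sdiff_of_subset h2, card_of_mem_U h1, card_of_mem_U hT]; omega
    obtain ⟨e, he⟩ := Finset.card_eq_one.1 this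
    refine ⟨e, (Finset.mem_sdiff.1 (he ▸ Finset.mem_singleton_self e)).2, ?_⟩
    rw [← Finset.sdiff_union_of_subset h2, he]; rfl
  have hmem : ∀ A, A ∈ D ↔ ∃ e ∈ E, A = insert e T := by
    intro A
    constructor
    · intro hA
      obtain ⟨e, he, rfl⟩ := hins A hA
      exact ⟨e, Finset.mem_sdiff.2 ⟨Finset.mem_biUnion.2 ⟨_, hA, Finset.mem_insert_self _ _⟩, he⟩,
        rfl⟩
    · rintro ⟨e, he, rfl⟩
      obtain ⟨he, heT⟩ := Finset.mem_sdiff.1 he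
      obtain ⟨A, hA, heA⟩ := Finset.mem_biUnion.1 he
      obtain ⟨e', -, rfl⟩ := hins A hA
      rcases Finset.mem_insert.1 heA with rfl | h
      · exact hA
      · exact absurd h heT
  have hEnot : ∀ e ∈ E, e ∉ T := fun e he => (Finset.mem_sdiff.1 he).2
  -- `G` contains `e` and all of `T` but `h`
  have hGe : ∀ e ∈ E, insert e (T.erase h) ⊆ G := by
    intro e he
    obtain ⟨h1, -, h3⟩ := hD _ ((hmem _).2 ⟨e, he, rfl⟩)
    have hne : e ≠ h := fun h' => hEnot e he (h' ▸ hhT)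
    have h4 : G ∩ insert e T ⊆ (insert e T).erase h := fun x hx => by
      rw [Finset.mem_inter] at hx
      exact Finset.mem_erase.2 ⟨fun h' => hhG (h' ▸ hx.1), hx.2⟩
    have h5 := Finset.eq_of_subset_of_card_le h4 (by
      rw [Finset.card_erase_of_mem (Finset.mem_insert_of_mem hhT), card_of_mem_U h1]; exact h3)
    rw [Finset.erase_insert_of_ne hne] at h5
    rw [← h5]
    exact Finset.inter_subset_left
  have hEG : E ⊆ G := fun e he => hGe e he (Finset.mem_insert_self _ _)
  have hEins : ∀ e ∈ E, insert e T ∈ U c k (t + 1) := fun e he =>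
    (hD _ ((hmem _).2 ⟨e, he, rfl⟩)).1
  obtain ⟨hdis, hTE⟩ := union_mem_U hT hG hEG hEins
  have hcard : E.card = D.card := by
    have : D = E.image fun e => insert e T := by
      ext A
      rw [hmem, Finset.mem_image]
      exact ⟨fun ⟨e, he, h⟩ => ⟨e, he, h.symm⟩, fun ⟨e, he, h⟩ => ⟨e, he, h.symm⟩⟩
    rw [this, Finset.card_image_of_injOn]
    intro e he e' he' hee
    have : e ∈ insert e' T := by
      have h' : insert e T = insert e' T := hee
      rw [← h']; exact Finset.mem_insert_self _ _
    exact (Finset.mem_insert.1 this).resolve_right (hEnot e he)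
  refine ⟨hEG, hmem, hcard, hcard ▸ hTE, ?_⟩
  by_contra hcon
  have hle := le_of_mem_U hc hTE
  have htE : t + E.card = k := by omega
  rw [htE] at hTE
  have hEpos : E.Nonempty := by
    by_contra hE0
    rw [Finset.not_nonempty_iff_eq_empty] at hE0
    rw [hE0, Finset.card_empty] at htE
    omega
  obtain ⟨e, he⟩ := hEpos
  have hSsub : (T ∪ E).erase h ⊆ G := fun x hx => by
    rw [Finset.mem_erase, Finset.mem_union] at hx
    rcases hx.2 with hxT | hxE
    · exact hGe e he (Finset.mem_insert_of_mem (Finset.mem_erase.2 ⟨hx.1, hxT⟩))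
    · exact hEG hxE
  have hS := mem_U_of_subset hTE (Finset.erase_subset h (T ∪ E))
  rw [Finset.card_erase_of_mem (Finset.mem_union_left _ hhT), card_of_mem_U hTE] at hS
  have := eq_of_common_pred hc (by omega) hS hG hTE hSsub (Finset.erase_subset _ _)
  exact hhG (this ▸ Finset.mem_union_left _ hhT)

end Maximal

/-! ### From the covers to the three types -/

lemma eq_of_sq_le_mul {a b n m : ℕ} (ha : a ≤ n) (hb : b ≤ n) (hnm : n ≤ m) (h : m ^ 2 ≤ a * b) :
    n = m ∧ a = n ∧ b = n := by
  rw [sq] at h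
  have hmn : m ≤ n := by
    by_contra hlt
    push Not at hlt
    exact absurd (h.trans (Nat.mul_le_mul ha hb)) (not_le.2 (Nat.mul_lt_mul'' hlt hlt))
  obtain rfl := le_antisymm hnm hmn
  refine ⟨rfl, ha.antisymm ?_, hb.antisymm ?_⟩
  · by_contra hlt
    push Not at hlt
    have := Nat.mul_le_mul_left a hb
    have := Nat.mul_lt_mul_of_pos_right hlt (show 0 < n by omega)
    omega
  · by_contra hlt
    push Not at hlt
    have := Nat.mul_le_mul_right b ha
    have := Nat.mul_lt_mul_of_pos_left hlt (show 0 < n by omega)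
    omega

section Types

variable {c k t j m : ℕ} {FF GG : Finset (BlockFamily c k)}

lemma IsMaxNontrivialCrossPair.mem_of_cover_subset (h : IsMaxNontrivialCrossPair c k t FF GG)
    (hG : GG.Nonempty) {s : ℕ} {A F : BlockFamily c k} (hA : A ∈ covers t s GG)
    (hF : F ∈ U c k k) (hAF : A ⊆ F) : F ∈ FF :=
  h.mem hG hF fun G hGG => by
    rw [Finset.inter_comm]
    exact ((mem_covers.1 hA).2 G hGG).trans
      (Finset.card_le_card (Finset.inter_subset_inter_left hAF))

lemma eq_N₂_of_covers_eq (ht : 1 ≤ t) (hmax : IsMaxNontrivialCrossPair c k t FF GG)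
    (hG : GG.Nonempty) {Z : BlockFamily c k} (hZ : Z.card = t + 2)
    (hA : covers t (t + 1) GG = Z.powersetCard (t + 1))
    (hB : covers t (t + 1) FF = Z.powersetCard (t + 1)) : FF = N₂ c k t Z := by
  ext F
  rw [mem_N₂]
  constructor
  · intro hF
    refine ⟨hmax.1.1 hF, ?_⟩
    have herase : ∀ x ∈ Z, t ≤ (F ∩ Z.erase x).card := fun x hx => by
      have : Z.erase x ∈ covers t (t + 1) FF := by
        rw [hB, Finset.mem_powersetCard]
        exact ⟨Finset.erase_subset _ _, by rw [Finset.card_erase_of_mem hx, hZ]; rfl⟩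
      exact (mem_covers.1 this).2 F hF
    obtain ⟨z, hz⟩ := Finset.card_pos.1 (show 0 < Z.card by omega)
    obtain ⟨x, hx⟩ := Finset.card_pos.1 (lt_of_lt_of_le ht (herase z hz))
    rw [Finset.mem_inter] at hx
    have hxZ := Finset.mem_of_mem_erase hx.2
    have h1 := herase x hxZ
    rw [Finset.inter_erase, Finset.card_erase_of_mem (Finset.mem_inter.2 ⟨hx.1, hxZ⟩)] at h1
    omega
  · rintro ⟨hF, hFZ⟩
    obtain ⟨A, hAF, hAc⟩ := Finset.exists_subset_card_eq hFZ
    refine hmax.mem_of_cover_subset hG (A := A) (s := t + 1) ?_ hF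
      (hAF.trans Finset.inter_subset_left)
    rw [hA, Finset.mem_powersetCard]
    exact ⟨hAF.trans Finset.inter_subset_right, hAc⟩

lemma isSecondType_of_hull (ht : 1 ≤ t) (hm : m = max (t + 2) j)
    (hmax : IsMaxNontrivialCrossPair c k t FF GG) (hF : FF.Nonempty) (hG : GG.Nonempty)
    (hlarge : m ^ 2 ≤ (covers t (t + 1) GG).card * (covers t (t + 1) FF).card)
    {Z : BlockFamily c k} (hZ : Z.card = t + 2) (hA : ∀ A ∈ covers t (t + 1) GG, A ⊆ Z)
    (hB : ∀ B ∈ covers t (t + 1) FF, B ⊆ Z) : j ≤ t + 2 ∧ IsSecondType c k t FF GG := by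
  have hmt : t + 2 ≤ m := hm ▸ le_max_left _ _
  have hmj : j ≤ m := hm ▸ le_max_right _ _
  have hsub : ∀ {HH : Finset (BlockFamily c k)}, (∀ A ∈ covers t (t + 1) HH, A ⊆ Z) →
      covers t (t + 1) HH ⊆ Z.powersetCard (t + 1) := fun h A hA' =>
    Finset.mem_powersetCard.2 ⟨h A hA', card_of_mem_U (mem_covers.1 hA').1⟩
  have hpc : (Z.powersetCard (t + 1)).card = t + 2 := by
    rw [Finset.card_powersetCard, hZ, Nat.choose_succ_self_right]
  have h1 := Finset.card_le_card (hsub hA)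
  have h2 := Finset.card_le_card (hsub hB)
  rw [hpc] at h1 h2
  obtain ⟨h3, h4, h5⟩ := eq_of_sq_le_mul h1 h2 hmt hlarge
  have hAeq := Finset.eq_of_subset_of_card_le (hsub hA) (by rw [hpc]; exact h4.ge)
  have hBeq := Finset.eq_of_subset_of_card_le (hsub hB) (by rw [hpc]; exact h5.ge)
  have hZU : Z ∈ U c k (t + 2) := by
    have hmem : ∀ a ∈ Z, ∀ b ∈ Z, ∃ S ∈ U c k (t + 1), a ∈ S ∧ b ∈ S := by
      intro a ha b hb
      have : (({a, b} : BlockFamily c k)).card < Z.card :=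
        Finset.card_le_two.trans_lt (by omega)
      obtain ⟨x, hx, hx'⟩ := Finset.exists_mem_notMem_of_card_lt_card this
      simp only [Finset.mem_insert, Finset.mem_singleton, not_or] at hx'
      refine ⟨Z.erase x, ?_, Finset.mem_erase.2 ⟨Ne.symm hx'.1, ha⟩,
        Finset.mem_erase.2 ⟨Ne.symm hx'.2, hb⟩⟩
      have : Z.erase x ∈ covers t (t + 1) FF := by
        rw [hBeq, Finset.mem_powersetCard]
        exact ⟨Finset.erase_subset _ _, by rw [Finset.card_erase_of_mem hx, hZ]; rfl⟩
      exact (mem_covers.1 this).1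
    refine mem_U.2 ⟨hZ, fun a ha => ?_, fun a ha b hb hne => ?_⟩
    · obtain ⟨S, hS, haS, -⟩ := hmem a ha a ha
      exact (mem_U.1 hS).2.1 a haS
    · obtain ⟨S, hS, haS, hbS⟩ := hmem a ha b hb
      exact (mem_U.1 hS).2.2 a haS b hbS hne
  refine ⟨h3 ▸ hmj, Z, hZU, eq_N₂_of_covers_eq ht hmax hG hZ hAeq hBeq,
    eq_N₂_of_covers_eq ht hmax.symm hF hZ hBeq hAeq⟩

lemma eq_N₃_of_covers_eq (hmax : IsMaxNontrivialCrossPair c k 1 FF GG) (hG : GG.Nonempty)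
    {e₁ e₂ e₃ e₄ : Finset (Fin (c * k))}
    (hA : covers 1 2 GG = {{e₁, e₂}, {e₃, e₄}, {e₁, e₄}})
    (hB : covers 1 2 FF = {{e₁, e₃}, {e₂, e₄}, {e₁, e₄}}) :
    FF = N₃ c k {e₁, e₂} {e₃, e₄} {e₁, e₄} := by
  ext F
  rw [mem_N₃]
  constructor
  · intro hF
    refine ⟨hmax.1.1 hF, ?_⟩
    have hmeet : ∀ a b, ({a, b} : BlockFamily c k) ∈ covers 1 2 FF → a ∈ F ∨ b ∈ F := by
      intro a b hab
      obtain ⟨x, hx⟩ := Finset.card_pos.1 ((mem_covers.1 hab).2 F hF)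
      simp only [Finset.mem_inter, Finset.mem_insert, Finset.mem_singleton] at hx
      obtain ⟨hx, rfl | rfl⟩ := hx
      · exact Or.inl hx
      · exact Or.inr hx
    have h1 := hmeet e₁ e₃ (by rw [hB]; simp)
    have h2 := hmeet e₂ e₄ (by rw [hB]; simp)
    have h3 := hmeet e₁ e₄ (by rw [hB]; simp)
    simp only [Finset.insert_subset_iff, Finset.singleton_subset_iff]
    tauto
  · rintro ⟨hF, h | h | h⟩
    · exact hmax.mem_of_cover_subset hG (s := 2) (by rw [hA]; simp) hF h
    · exact hmax.mem_of_cover_subset hG (s := 2) (by rw [hA]; simp) hF h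
    · exact hmax.mem_of_cover_subset hG (s := 2) (by rw [hA]; simp) hF h

lemma isThirdType_of_isSquarePair (hmax : IsMaxNontrivialCrossPair c k 1 FF GG)
    (hF : FF.Nonempty) (hG : GG.Nonempty) (h : IsSquarePair (covers 1 2 GG) (covers 1 2 FF)) :
    IsThirdType c k FF GG := by
  obtain ⟨e₁, e₂, e₃, e₄, hA, hB⟩ := h
  have memA : ∀ S ∈ covers 1 2 GG, S ∈ U c k 2 := fun S hS => (mem_covers.1 hS).1
  have memB : ∀ S ∈ covers 1 2 FF, S ∈ U c k 2 := fun S hS => (mem_covers.1 hS).1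
  rw [hA] at memA
  rw [hB] at memB
  exact ⟨e₁, e₂, e₃, e₄, memA _ (by simp), memA _ (by simp), memB _ (by simp), memB _ (by simp),
    memA _ (by simp), eq_N₃_of_covers_eq hmax hG hA hB,
    eq_N₃_of_covers_eq hmax.symm hF hB hA⟩

/-- If a partition `G` contains all blocks of `L` but `h`, where `L` has `k - 1` blocks, then each
of the two other blocks of `G` meets `h`. -/
lemma not_disjoint_of_notMem (hc : 0 < c) (hk : 0 < k) {L G : BlockFamily c k}
    (hL : L ∈ U c k (k - 1)) (hG : G ∈ U c k k) {h : Finset (Fin (c * k))} (hhL : h ∈ L)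
    (hhG : h ∉ G) (hsub : L.erase h ⊆ G) {x : Finset (Fin (c * k))} (hxG : x ∈ G) (hxL : x ∉ L) :
    ¬ Disjoint x h := by
  intro hd
  obtain ⟨-, hU⟩ := insert_mem_U hc hL (e := x) ((mem_U.1 hG).2.1 x hxG) (fun a ha => by
    by_cases hah : a = h
    · exact hah ▸ hd.symm
    · exact (mem_U.1 hG).2.2 a (hsub (Finset.mem_erase.2 ⟨hah, ha⟩)) x hxG (fun e => hxL (e ▸ ha)))
  rw [Nat.sub_add_cancel hk] at hU
  have hS := mem_U_of_subset hU (Finset.insert_subset_insert x (Finset.erase_subset h L))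
  rw [Finset.card_insert_of_notMem (fun h' => hxL (Finset.mem_of_mem_erase h')),
    Finset.card_erase_of_mem hhL, card_of_mem_U hL,
    Nat.sub_add_cancel (by have := Finset.card_pos.2 ⟨h, hhL⟩; rwa [card_of_mem_U hL] at this)] at hS
  have := eq_of_common_pred hc hk hS hG hU (Finset.insert_subset hxG hsub)
    (Finset.insert_subset_insert x (Finset.erase_subset h L))
  exact hhG (this ▸ Finset.mem_insert_of_mem hhL)

/-- What it means for the covers of `GG` to form a star with the maximum number `j` of members. -/
lemma star_covers_facts (hc : 0 < c) (hj : t + 1 + j = k) (hj2 : 2 ≤ j)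
    (hpair : IsNontrivialCrossPair c k t FF GG) {T : BlockFamily c k} (hT : T ∈ U c k t)
    (hA : ∀ A ∈ covers t (t + 1) GG, T ⊆ A) (hcard : (covers t (t + 1) GG).card = j) :
    ∃ L ∈ U c k (k - 1), T ⊆ L ∧ (∀ G ∈ GG, ¬ T ⊆ G → (G ∩ L).card = k - 2) ∧
      ∀ F ∈ FF, T ⊆ F → t + 1 ≤ (F ∩ L).card := by
  obtain ⟨hFU, hGU, hcr, hcF, hcG⟩ := hpair
  have hD : ∀ G ∈ GG, ∀ A ∈ covers t (t + 1) GG, A ∈ U c k (t + 1) ∧ T ⊆ A ∧ t ≤ (G ∩ A).card :=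
    fun G hG A hAm =>
    ⟨(mem_covers.1 hAm).1, hA A hAm, (mem_covers.1 hAm).2 G hG⟩
  obtain ⟨G₀, hG₀, hTG₀⟩ := exists_not_subset hcG (card_of_mem_U hT)
  obtain ⟨E, hE⟩ : ∃ E, E = (covers t (t + 1) GG).biUnion id \ T := ⟨_, rfl⟩
  obtain ⟨-, hmem, hEc, hL, -⟩ := star_structure hc (by omega) hT (hGU hG₀) hTG₀ (hD G₀ hG₀)
  rw [← hE] at hmem hEc hL
  rw [hcard] at hEc hL
  rw [show t + j = k - 1 by omega] at hL
  have hTE : Disjoint T E := hE ▸ Finset.disjoint_sdiff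
  have hGL : ∀ G ∈ GG, ¬ T ⊆ G → (G ∩ (T ∪ E)).card = k - 2 := by
    intro G hG hTG
    obtain ⟨hEG, -⟩ := star_structure hc (by omega) hT (hGU hG) hTG (hD G hG)
    rw [← hE] at hEG
    obtain ⟨e, he⟩ := Finset.card_pos.1 (show 0 < E.card by omega)
    have h1 := (hD G hG _ ((hmem _).2 ⟨e, he, rfl⟩)).2.2
    have h2 : (G ∩ insert e T).card ≤ (G ∩ T).card + 1 := by
      refine (Finset.card_le_card (t := insert e (G ∩ T)) fun x hx => ?_).trans
        (Finset.card_insert_le _ _)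
      simp only [Finset.mem_inter, Finset.mem_insert] at hx ⊢
      tauto
    have h3 : (G ∩ T).card < t := by
      rw [← card_of_mem_U hT]
      exact Finset.card_lt_card ⟨Finset.inter_subset_right,
        fun h => hTG fun x hx => (Finset.mem_inter.1 (h hx)).1⟩
    rw [Finset.inter_union_distrib_left, Finset.inter_eq_right.2 hEG,
      Finset.card_union_of_disjoint (hTE.mono_left Finset.inter_subset_right), hEc]
    omega
  refine ⟨T ∪ E, hL, Finset.subset_union_left, hGL, ?_⟩
  intro F hF hTF
  by_contra hlt
  obtain ⟨h, hhT, hhG, hsub⟩ := exists_erase_subset hL Finset.subset_union_left hTG₀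
    (hGL G₀ hG₀ hTG₀)
  have hTFL : T = F ∩ (T ∪ E) := Finset.eq_of_subset_of_card_le
    (Finset.subset_inter hTF Finset.subset_union_left) (by rw [card_of_mem_U hT]; omega)
  have : ∃ x ∈ F ∩ G₀, x ∉ T.erase h := by
    by_contra! hcon
    have h1 := Finset.card_le_card (show F ∩ G₀ ⊆ T.erase h from hcon)
    have h2 := hcr F hF G₀ hG₀
    have h3 := Finset.card_erase_lt_of_mem hhT
    rw [card_of_mem_U hT] at h3
    omega
  obtain ⟨x, hx, hxT⟩ := this
  rw [Finset.mem_inter] at hx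
  have hxh : x ≠ h := fun e => hhG (e ▸ hx.2)
  have hxL : x ∉ T ∪ E := fun hxL => hxT (Finset.mem_erase.2 ⟨hxh, by
    rw [hTFL]; exact Finset.mem_inter.2 ⟨hx.1, hxL⟩⟩)
  exact not_disjoint_of_notMem hc (by omega) hL (hGU hG₀) (Finset.mem_union_left _ hhT) hhG hsub
    hx.2 hxL ((mem_U.1 (hFU hF)).2.2 x hx.1 h (hTF hhT) hxh)

/-- If `L` and `M` share too few blocks, then some member of `N₁ T L M` shares fewer than `t` blocks
with a given partition `G` that contains all of `L` but a block of `T`. -/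
lemma exists_mem_N₁_card_inter_lt (hc : 0 < c) (ht : 1 ≤ t) (hk : t + 3 ≤ k)
    (hp2 : 3 * partitionCount c 1 < partitionCount c 2) {T L M G : BlockFamily c k}
    (hT : T ∈ U c k t) (hL : L ∈ U c k (k - 1)) (hM : M ∈ U c k (k - 1)) (hTL : T ⊆ L)
    (hTM : T ⊆ M) (hG : G ∈ U c k k) (hTG : ¬ T ⊆ G) (hGL : (G ∩ L).card = k - 2)
    (hLM : (L ∩ M).card < t + min t 2) :
    ∃ F ∈ N₁ c k t T L M, (F ∩ G).card < t := by
  obtain ⟨h', hhT', hhG', hsub'⟩ := exists_erase_subset hL hTL hTG hGL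
  obtain ⟨h, hhT, hhh⟩ : ∃ h ∈ T, t = 1 ∨ h ≠ h' := by
    by_cases ht1 : t = 1
    · exact ⟨h', hhT', Or.inl ht1⟩
    · obtain ⟨h, hh, hne⟩ := Finset.exists_mem_ne (s := T) (by rw [card_of_mem_U hT]; omega) h'
      exact ⟨h, hh, Or.inr hne⟩
  have hS := mem_U_of_subset hM (Finset.erase_subset h M)
  have hMc : (M.erase h).card = k - 2 := by
    rw [Finset.card_erase_of_mem (hTM hhT), card_of_mem_U hM]; omega
  rw [hMc] at hS
  have hX : (insert h (G \ L)).card ≤ 3 := by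
    refine (Finset.card_insert_le _ _).trans ?_
    have := Finset.card_sdiff_add_card_inter G L
    rw [card_of_mem_U hG] at this
    omega
  have hdX : Disjoint (M.erase h) (insert h (G \ L)) := by
    rw [Finset.disjoint_insert_right]
    refine ⟨Finset.notMem_erase _ _, Finset.disjoint_left.2 fun x hxM hxG => ?_⟩
    rw [Finset.mem_sdiff] at hxG
    refine not_disjoint_of_notMem hc (by omega) hL hG (hTL hhT') hhG' hsub' hxG.1 hxG.2 ?_
    exact (mem_U.1 hM).2.2 x (Finset.mem_of_mem_erase hxM) h' (hTM hhT')
      (fun e => hxG.2 (e ▸ hTL hhT'))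
  obtain ⟨F, hF, hSF, hd⟩ := exists_above_disjoint hc hS hdX (by
    rw [show k - (k - 2) = 2 by omega]
    exact lt_of_le_of_lt (Nat.mul_le_mul_right _ hX) hp2)
  rw [Finset.disjoint_insert_right] at hd
  have hFM : F ∩ M = M.erase h := by
    refine Finset.Subset.antisymm (fun x hx => ?_)
      (Finset.subset_inter hSF (Finset.erase_subset _ _))
    rw [Finset.mem_inter] at hx
    exact Finset.mem_erase.2 ⟨fun e => hd.1 (e ▸ hx.1), hx.2⟩
  refine ⟨F, mem_N₁.2 ⟨hF, Or.inr ⟨fun h0 => hd.1 (h0 hhT), by rw [hFM, hMc]⟩⟩, ?_⟩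
  have hsub : F ∩ G ⊆ ((L ∩ M).erase h).erase h' := by
    intro x hx
    rw [Finset.mem_inter] at hx
    have hxL : x ∈ L := by
      by_contra hxL
      exact Finset.disjoint_left.1 hd.2 hx.1 (Finset.mem_sdiff.2 ⟨hx.2, hxL⟩)
    have hxh : x ≠ h := fun e => hd.1 (e ▸ hx.1)
    have hxM : x ∈ M := by
      by_contra hxM
      exact not_disjoint_of_notMem hc (by omega) hM hF (hTM hhT) hd.1 hSF hx.1 hxM
        ((mem_U.1 hL).2.2 x hxL h (hTL hhT) hxh)
    exact Finset.mem_erase.2 ⟨fun e => hhG' (e ▸ hx.2),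
      Finset.mem_erase.2 ⟨hxh, Finset.mem_inter.2 ⟨hxL, hxM⟩⟩⟩
  have h1 := Finset.card_le_card hsub
  have hhLM : h ∈ L ∩ M := Finset.mem_inter.2 ⟨hTL hhT, hTM hhT⟩
  have hhLM' : h' ∈ L ∩ M := Finset.mem_inter.2 ⟨hTL hhT', hTM hhT'⟩
  have h2 := Finset.card_erase_of_mem hhLM
  have h3 := Finset.card_pos.2 ⟨h, hhLM⟩
  rcases hhh with ht1 | hne
  · have h4 := Finset.card_erase_le (s := (L ∩ M).erase h) (a := h')
    omega
  · have hmem : h' ∈ (L ∩ M).erase h := Finset.mem_erase.2 ⟨hne.symm, hhLM'⟩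
    have h4 := Finset.card_erase_of_mem hmem
    have h5 := Finset.card_pos.2 ⟨h', hmem⟩
    omega

lemma isFirstType_of_star (hc : 0 < c) (ht : 1 ≤ t) (hj : t + 1 + j = k) (hj2 : 2 ≤ j)
    (hp : partitionCount c (j - 1) < partitionCount c j)
    (hp2 : 3 * partitionCount c 1 < partitionCount c 2)
    (hmax : IsMaxNontrivialCrossPair c k t FF GG) (hG : GG.Nonempty) {T : BlockFamily c k}
    (hT : T.card = t) (hA : ∀ A ∈ covers t (t + 1) GG, T ⊆ A)
    (hB : ∀ B ∈ covers t (t + 1) FF, T ⊆ B) (hAj : (covers t (t + 1) GG).card = j)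
    (hBj : (covers t (t + 1) FF).card = j) : IsFirstType c k t FF GG := by
  have hTU : T ∈ U c k t := by
    obtain ⟨A, hAm⟩ := Finset.card_pos.1 (show 0 < (covers t (t + 1) GG).card by omega)
    exact hT ▸ mem_U_of_subset (mem_covers.1 hAm).1 (hA A hAm)
  obtain ⟨L, hL, hTL, hGL, hFL⟩ := star_covers_facts hc hj hj2 hmax.1 hTU hA hAj
  obtain ⟨M, hM, hTM, hFM, hGM⟩ := star_covers_facts hc hj hj2 hmax.symm.1 hTU hB hBj
  obtain ⟨hFU, hGU, hcr, hcF, hcG⟩ := hmax.1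
  have hFsub : FF ⊆ N₁ c k t T L M := fun F hF => mem_N₁.2 ⟨hFU hF, by
    by_cases hTF : T ⊆ F
    · exact Or.inl ⟨hTF, hFL F hF hTF⟩
    · exact Or.inr ⟨hTF, hFM F hF hTF⟩⟩
  have hGsub : GG ⊆ N₁ c k t T M L := fun G hG => mem_N₁.2 ⟨hGU hG, by
    by_cases hTG : T ⊆ G
    · exact Or.inl ⟨hTG, hGM G hG hTG⟩
    · exact Or.inr ⟨hTG, hGL G hG hTG⟩⟩
  have hFc := Finset.card_le_card hFsub
  have hGc := Finset.card_le_card hGsub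
  have hGpos := Finset.card_pos.2 hG
  by_cases hLM : t + min t 2 ≤ (L ∩ M).card
  · have hU : ∀ L M, N₁ c k t T L M ⊆ U c k k := fun L M F hF => (mem_N₁.1 hF).1
    have h1 := hmax.2 (N₁ c k t T L M) (N₁ c k t T M L)
      ⟨hU L M, hU M L, crossIntersecting_N₁ hTU hL hM hTL hTM hLM,
        (card_commonBlocks_le hFsub).trans_lt hcF, (card_commonBlocks_le hGsub).trans_lt hcG⟩
    have hFpos : 0 < FF.card := by
      obtain ⟨F, hF, -⟩ := exists_not_subset hcF hT
      exact Finset.card_pos.2 ⟨F, hF⟩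
    refine ⟨T, hTU, L, hL, M, hM, Finset.subset_inter hTL hTM, hLM,
      Finset.eq_of_subset_of_card_le hFsub ?_, Finset.eq_of_subset_of_card_le hGsub ?_⟩
    · by_contra hlt
      push Not at hlt
      nlinarith
    · by_contra hlt
      push Not at hlt
      nlinarith
  · exfalso
    obtain ⟨G, hGm, hTG⟩ := exists_not_subset hcG hT
    obtain ⟨F, hF, hFG⟩ := exists_mem_N₁_card_inter_lt hc ht (by omega) hp2 hTU hL hM hTL hTM
      (hGU hGm) hTG (hGL G hGm hTG) (not_le.1 hLM)
    have hlt : FF.card < (N₁ c k t T L M).card :=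
      Finset.card_lt_card ⟨hFsub, fun h => absurd (hcr F (h hF) G hGm) (not_le.2 hFG)⟩
    have hp2' : partitionCount c 1 < partitionCount c 2 := by omega
    have h1 := hmax.2 _ _ (isNontrivialCrossPair_N₁ hc ht hj hj2 hp hp2' hTU hL hTL)
    have h2 := hmax.2 _ _ (isNontrivialCrossPair_N₁ hc ht hj hj2 hp hp2' hTU hM hTM)
    -- `N₁ T L M` has as many members as `N₁ T L L`
    rw [card_N₁ hc (by omega) hTU hL hTL, ← card_N₁ (M := M) hc (by omega) hTU hM hTM] at h1
    rw [card_N₁ hc (by omega) hTU hM hTM, ← card_N₁ (M := L) hc (by omega) hTU hL hTL] at h2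
    have h3 := Nat.le_of_mul_le_mul_right (h2.trans (Nat.mul_le_mul_left FF.card hGc))
      (hGpos.trans_le hGc)
    have h4 := Nat.mul_lt_mul'' hlt hlt
    have h5 := Nat.mul_le_mul_left FF.card (hGc.trans h3)
    omega

/-- At `j = t + 2` the leading terms of the sizes of `N₁` and `N₂` agree, and the next terms
decide. -/
lemma card_N₁_lt_card_N₂ (hc : 0 < c) (ht : 2 ≤ t) (hj : t + 1 + (t + 2) = k)
    (hp : 2 * partitionCount c t ≤ partitionCount c (t + 1)) {T L M Z : BlockFamily c k}
    (hT : T ∈ U c k t) (hL : L ∈ U c k (k - 1)) (hM : M ∈ U c k (k - 1)) (hTL : T ⊆ L)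
    (hTM : T ⊆ M) (hZ : Z ∈ U c k (t + 2)) :
    (N₁ c k t T L M).card < (N₂ c k t Z).card := by
  have h1 := card_superset_inter_le hc hj (by omega) hT hL hTL
  have h2 := card_N₂_ge hc hj hZ
  rw [show t + 2 - 1 = t + 1 by omega] at h1 h2
  rw [Nat.add_sub_cancel] at h1
  rw [card_N₁ hc (by omega) hT hM hTM]
  have h3 : partitionCount c (t + 1) ≤ partitionCount c (t + 2) := partitionCount_mono (by omega)
  have h4 : partitionCount c 2 ≤ partitionCount c t := partitionCount_mono ht
  have h5 := partitionCount_pos (c := c) 1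
  have h5' := partitionCount_pos (c := c) t
  have h6 : t * (partitionCount c 2 - partitionCount c 1) + t * partitionCount c t <
      t * partitionCount c (t + 1) := by
    rw [← Nat.mul_add]
    exact Nat.mul_lt_mul_of_pos_left (by omega) (by omega)
  zify [h3] at h1 h2 ⊢
  zify at h6
  nlinarith

end Types

lemma nonempty_of_isNontrivialCrossPair {c k t : ℕ} {FF GG : Finset (BlockFamily c k)} (hc : 0 < c)
    (hk : t ≤ k) (h : IsNontrivialCrossPair c k t FF GG) : FF.Nonempty := by
  obtain ⟨T, hT⟩ := exists_mem_U (c := c) hc hk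
  obtain ⟨F, hF, -⟩ := exists_not_subset h.2.2.2.1 (card_of_mem_U hT)
  exact ⟨F, hF⟩

/-- At most `j` covers of `GG` with `t + 1` blocks contain `t` given blocks. -/
lemma card_covers_filter_superset_le {c k t j : ℕ} {FF GG : Finset (BlockFamily c k)} (hc : 0 < c)
    (hj : t + 1 + j = k) (hpair : IsNontrivialCrossPair c k t FF GG) {T : BlockFamily c k}
    (hT : T.card = t) : ((covers t (t + 1) GG).filter (T ⊆ ·)).card ≤ j := by
  rcases ((covers t (t + 1) GG).filter (T ⊆ ·)).eq_empty_or_nonempty with h0 | ⟨A, hAm⟩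
  · rw [h0]; exact Nat.zero_le _
  · obtain ⟨hA, hTA⟩ := Finset.mem_filter.1 hAm
    have hTU := hT ▸ mem_U_of_subset (mem_covers.1 hA).1 hTA
    obtain ⟨G, hGm, hTG⟩ := exists_not_subset hpair.2.2.2.2 hT
    have := (star_structure hc (by omega) hTU (hpair.2.1 hGm) hTG
      (D := (covers t (t + 1) GG).filter (T ⊆ ·)) fun A hA => by
        obtain ⟨hA, hTA⟩ := Finset.mem_filter.1 hA
        exact ⟨(mem_covers.1 hA).1, hTA, (mem_covers.1 hA).2 G hGm⟩).2.2.2.2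
    omega

lemma not_isFirstType {c k t : ℕ} {FF GG : Finset (BlockFamily c k)} (hc : 0 < c) (ht : 2 ≤ t)
    (hj : t + 1 + (t + 2) = k) (hp : partitionCount c (t + 1) < partitionCount c (t + 2))
    (hp' : 2 * partitionCount c t ≤ partitionCount c (t + 1))
    (hmax : IsMaxNontrivialCrossPair c k t FF GG) : ¬ IsFirstType c k t FF GG := by
  rintro ⟨T, hT, L, hL, M, hM, hTLM, -, hFe, hGe⟩
  obtain ⟨hTL, hTM⟩ := Finset.subset_inter_iff.1 hTLM
  obtain ⟨Z, hZ⟩ := exists_mem_U (c := c) (k := k) (s := t + 2) hc (by omega)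
  have h5 := card_N₁_lt_card_N₂ hc ht hj hp' hT hL hM hTL hTM hZ
  have h6 := card_N₁_lt_card_N₂ hc ht hj hp' hT hM hL hTM hTL hZ
  rw [← hFe] at h5
  rw [← hGe] at h6
  have h7 := hmax.2 _ _ (isNontrivialCrossPair_N₂ hc (by omega) hj hp hZ)
  exact absurd h7 (not_le.2 (Nat.mul_lt_mul'' h5 h6))

/-- In a maximum pair the numbers of covers with `t + 1` blocks have product at least
`max (t + 2) j ^ 2`. -/
lemma sq_le_card_covers_mul_card_covers {c k t j m : ℕ} {FF GG : Finset (BlockFamily c k)}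
    (hc : 0 < c) (ht : 1 ≤ t) (hj : t + 1 + j = k) (hj2 : 2 ≤ j) (hm : m = max (t + 2) j)
    (hg1 : 7 * m ^ 5 ≤ blockRatio c j)
    (hg2 : ∀ i d, 2 ≤ i → 1 ≤ d → i + d = j → (t + d + 2) * i ≤ blockRatio c i * (d + 2))
    (hP : 7 * m ^ 5 * partitionCount c (j - 1) ≤ partitionCount c j)
    (hp1 : partitionCount c (j - 1) < partitionCount c j)
    (hp2 : partitionCount c 1 < partitionCount c 2) (hF : FF.Nonempty) (hG : GG.Nonempty)
    (hmax : IsMaxNontrivialCrossPair c k t FF GG) :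
    (covers t (t + 1) GG).Nonempty ∧
      m ^ 2 ≤ (covers t (t + 1) GG).card * (covers t (t + 1) FF).card := by
  obtain ⟨N, hN, hNFG⟩ := exists_benchmark hc ht hj hj2 hm hp1 hp2 hmax
  obtain ⟨hBne, hAne⟩ := covers_nonempty hc hj hm hP
    (fun d hd hdj => two_mul_coverWeight_le ht hj2 hm hg1 hg2 hd hdj) hmax.1 hF hG hN hNFG
  have hUF := card_le_card_covers_mul hc hj hmax.1 hG hBne
  have hUG := card_le_card_covers_mul hc hj hmax.1.symm hF hAne
  refine ⟨hAne, ?_⟩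
  by_contra hlt
  exact absurd hNFG (not_le.2 (mul_lt_sq_of_main_term hm ht hP (partitionCount_pos _) hN
    (Finset.card_pos.2 hAne) (Finset.card_pos.2 hBne) (not_le.1 hlt) hUF hUG))

/-- The classification of the maximum pairs, with the range of `k = t + 1 + j` for each type. -/
lemma classification {c k t j : ℕ} (ht : 1 ≤ t) (hc : 6 ≤ c) (hj : t + 1 + j = k) (hj2 : 2 ≤ j)
    (hckt : 4 * Real.logb 2 (t : ℝ) + 7 ≤ (c : ℝ) ∨ t + 2 ≤ j)
    {FF GG : Finset (BlockFamily c k)} (hmax : IsMaxNontrivialCrossPair c k t FF GG) :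
    (IsThirdType c k FF GG ∧ t = 1 ∧ j ≤ 3) ∨
      (IsFirstType c k t FF GG ∧ t + 2 ≤ j ∧ ¬ (j = t + 2 ∧ 2 ≤ t)) ∨
      (IsSecondType c k t FF GG ∧ j ≤ t + 2) := by
  have hc0 : 0 < c := by omega
  obtain ⟨m, hm⟩ : ∃ m, m = max (t + 2) j := ⟨_, rfl⟩
  have hmt : t + 2 ≤ m := hm ▸ le_max_left _ _
  have hmj : j ≤ m := hm ▸ le_max_right _ _
  obtain ⟨hg1, hg2⟩ := growth_estimates ht hc hj2 hckt
  rw [← hm] at hg1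
  have hpr : partitionCount c j = blockRatio c j * partitionCount c (j - 1) := by
    obtain ⟨i, rfl⟩ : ∃ i, j = i + 1 := ⟨j - 1, by omega⟩
    exact partitionCount_succ i
  have hq := partitionCount_pos (c := c) (j - 1)
  have hP : 7 * m ^ 5 * partitionCount c (j - 1) ≤ partitionCount c j := by
    rw [hpr]; exact Nat.mul_le_mul_right _ hg1
  have hm5 : m ≤ m ^ 5 := Nat.le_self_pow (by norm_num) m
  have hpt : (t + 1) * partitionCount c (j - 1) < partitionCount c j :=
    lt_of_lt_of_le (Nat.mul_lt_mul_of_pos_right (by omega) hq) hP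
  have hp1 : partitionCount c (j - 1) < partitionCount c j :=
    lt_of_le_of_lt (Nat.le_mul_of_pos_left _ (by omega)) hpt
  have hp2 : 3 * partitionCount c 1 < partitionCount c 2 := by
    have : 2 * 2 ^ 2 ≤ blockRatio c (1 + 1) := two_mul_sq_le_blockRatio hc le_rfl
    rw [partitionCount_succ 1, partitionCount_one]
    omega
  have hF := nonempty_of_isNontrivialCrossPair hc0 (by omega) hmax.1
  have hG := nonempty_of_isNontrivialCrossPair hc0 (by omega) hmax.1.symm
  obtain ⟨hAne, hlarge⟩ := sq_le_card_covers_mul_card_covers hc0 ht hj hj2 hm hg1 hg2 hP hp1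
    (by omega) hF hG hmax
  rcases crossIntersecting_structure hm ht
    (fun A hA => card_of_mem_U (mem_covers.1 hA).1)
    (fun B hB => card_of_mem_U (mem_covers.1 hB).1) hAne
    (fun A hA B hB => card_inter_covers hc0 hj hpt hmax hG hA hB)
    (fun T hT => card_covers_filter_superset_le hc0 hj hmax.1 hT)
    (fun T hT => card_covers_filter_superset_le hc0 hj hmax.symm.1 hT)
    with h | ⟨rfl, hj3, h⟩ | ⟨T, hT, hA, hB⟩ | ⟨Z, hZ, hA, hB⟩
  · exact absurd h (not_lt.2 hlarge)
  · exact Or.inl ⟨isThirdType_of_isSquarePair hmax hF hG h, rfl, hj3⟩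
  · right; left
    have h1 := card_covers_filter_superset_le hc0 hj hmax.1 hT
    have h2 := card_covers_filter_superset_le hc0 hj hmax.symm.1 hT
    rw [Finset.filter_true_of_mem hA] at h1
    rw [Finset.filter_true_of_mem hB] at h2
    obtain ⟨hjm, h3, h4⟩ := eq_of_sq_le_mul h1 h2 hmj hlarge
    have hfirst := isFirstType_of_star hc0 ht hj hj2 hp1 hp2 hmax hG hT hA hB h3 h4
    refine ⟨hfirst, hjm ▸ hmt, ?_⟩
    rintro ⟨rfl, ht2⟩
    refine not_isFirstType hc0 ht2 hj hp1 ?_ hmax hfirst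
    rw [partitionCount_succ t]
    refine Nat.mul_le_mul_right _ (le_trans ?_ (two_mul_sq_le_blockRatio hc (by omega)))
    exact Nat.le_mul_of_pos_right 2 (by positivity)
  · right; right
    have := isSecondType_of_hull ht hm hmax hF hG hlarge hZ hA hB
    exact ⟨this.2, this.1⟩

end UniformPartition

theorem theorem1p2 (c k t : ℕ) (ht : 1 ≤ t) (hc : 6 ≤ c) (hk : t + 3 ≤ k)
    (hckt : 4 * Real.logb 2 (t : ℝ) + 7 ≤ (c : ℝ) ∨ 2 * t + 3 ≤ k)
    (FF GG : Finset (UniformPartition.BlockFamily c k))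
    (hmax : UniformPartition.IsMaxNontrivialCrossPair c k t FF GG) :
    (UniformPartition.IsFirstType c k t FF GG ∨ UniformPartition.IsSecondType c k t FF GG ∨
      UniformPartition.IsThirdType c k FF GG) ∧
    ((k = 4 ∧ t = 1) ∨ (k = 5 ∧ t = 1) →
      UniformPartition.IsFirstType c k t FF GG ∨ UniformPartition.IsSecondType c k t FF GG ∨
        UniformPartition.IsThirdType c k FF GG) ∧
    (k = t + 3 ∧ 2 ≤ t →
      UniformPartition.IsFirstType c k t FF GG ∨ UniformPartition.IsSecondType c k t FF GG) ∧
    (t + 4 ≤ k ∧ k ≤ 2 * t + 3 ∧ ¬ (k = 5 ∧ t = 1) →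
      UniformPartition.IsSecondType c k t FF GG) ∧
    (2 * t + 4 ≤ k → UniformPartition.IsFirstType c k t FF GG) := by
  obtain ⟨j, hj⟩ : ∃ j, t + 1 + j = k := ⟨k - t - 1, by omega⟩
  have hmain := UniformPartition.classification ht hc hj (by omega)
    (hckt.imp_right fun h => by omega) hmax
  refine ⟨?_, fun _ => ?_, fun h => ?_, fun h => ?_, fun h => ?_⟩
  · tauto
  · tauto
  · rcases hmain with ⟨-, h1, -⟩ | ⟨h1, -⟩ | ⟨h1, -⟩
    · omega
    · exact Or.inl h1
    · exact Or.inr h1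
  · rcases hmain with ⟨-, h1, h2⟩ | ⟨-, h1, h2⟩ | ⟨h1, -⟩
    · omega
    · omega
    · exact h1
  · rcases hmain with ⟨-, h1, h2⟩ | ⟨h1, -⟩ | ⟨-, h1⟩
    · omega
    · exact h1
    · omega
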